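/- Let $\beta\in(0,1)$, $a>0$, $\rho\in\mathbb R$, let $\gamma_x,\gamma_\xi,\gamma_y\ge 0$ with $\gamma_\xi+\gamma_y>0$, and let $h$ be a probability law on $(0,\infty)$ with finite mean. In each period $t$ a firm observes an investment cost $f_t$, where $(f_t)$ is i.i.d. with law $h$, and either pays it and enters a market, or waits. Entering yields a dividend $x=\xi+\epsilon^x$ with $\epsilon^x\sim N(0,\gamma_x)$ independent of $\xi$, valued by $u(x)=(1-e^{-ax})/a$; the firm believes that $\xi\sim N(\mu,\gamma)$. The persistent component follows $\xi'=\rho\xi+\epsilon^\xi$, $\epsilon^\xi\sim N(0,\gamma_\xi)$, and a firm that waits observes $y'=\xi'+\epsilon^y$, $\epsilon^y\sim N(0,\gamma_y)$, so that $y'$ has predictive law $N(\rho\mu,\rho^2\gamma+\gamma_\xi+\gamma_y)$; it then updates its belief to $$\gamma'=\Big[\tfrac1\gamma+\tfrac{\rho^2}{\gamma_\xi+\gamma_y}\Big]^{-1},\qquad \mu'=\gamma'\Big[\tfrac{\mu}{\gamma}+\tfrac{\rho y'}{\gamma_\xi+\gamma_y}\Big].$$ The state $Z_t=(f_t,\mu_t,\gamma_t)$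 is thus a Markov process on $\mathsf Z=(0,\infty)\times\mathsf Y$, $\mathsf Y=\mathbb R\times(0,\infty)$, whose next value $(f',\mu',\gamma')$ is obtained from independent $f'\sim h$ and $y'\sim N(\rho\mu,\rho^2\gamma+\gamma_\xi+\gamma_y)$. Write $r(f,\mu,\gamma)=\mathbb E_{\mu,\gamma}[u(x)]-f$ for the exit payoff; the flow continuation payoff is $0$. Let $$v^*(z)=\sup_\tau \mathbb E_z\big[\beta^\tau r(Z_\tau)\big],\qquad \psi^*(\mu,\gamma)=\beta\,\mathbb E_{\mu,\gamma}\big[v^*(f',\mu',\gamma')\big],$$ where the supremum is over the almost surely finite stopping times $\tau$ of the filtration generated by $(Z_t)$, be the value function and the continuation value function, and let $$Q\psi(\mu,\gamma)=\beta\,\mathbb E_{\mu,\gamma}\big[\max\{r(f',\mu',\gamma'),\psi(\mu',\gamma')\}\big].$$ For $d'>0$ let $\ell(\mu,\gamma)=e^{-a\mu+a^2\gamma/2}+d'$, let $\|\psi\|_\ell=\sup_{\mathsf Y}|\psi|/\ell$, and let $b_\ell\mathsf Y$ be the space of measurable $\psi:\mathsf Y\to\mathbb R$ with $\|\psi\|_\ell<\infty$.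 Then $v^*$ is finite, the expectations above are well defined, and the following hold. 1. For every $d'>0$, $Q$ is a contraction mapping on $(b_\ell\mathsf Y,\|\cdot\|_\ell)$, of modulus $\beta$, and $\psi^*$ is its unique fixed point in $b_\ell\mathsf Y$. 2. For all $(f,\mu,\gamma)\in\mathsf Z$, $v^*(f,\mu,\gamma)=\max\{r(f,\mu,\gamma),\psi^*(\mu,\gamma)\}$. The reservation cost $\bar f:\mathsf Y\to\mathbb R$, that is, the unique function for which $\mathbb E_{\mu,\gamma}[u(x)]-\bar f(\mu,\gamma)=\psi^*(\mu,\gamma)$ (indifference between entering and waiting; its values may be nonpositive), is $\bar f(\mu,\gamma)=\mathbb E_{\mu,\gamma}[u(x)]-\psi^*(\mu,\gamma)$. The policy $\sigma^*(f,\mu,\gamma)=\mathbf 1\{f\le\bar f(\mu,\gamma)\}$ is optimal: $\tau^*=\inf\{t\ge 0:\sigma^*(Z_t)=1\}$ is a (possibly infinite) stopping time and, with payoff $0$ on the event that the firm never enters, its expected payoff from every $z\in\mathsf Z$ equals $v^*(z)$ and is at least that of every stopping time, finite or not. 3. $\psi^*$, $v^*$ and $\bar f$ are continuous. 4. $v^*$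 is (weakly) decreasing in $f$; and if $\rho\ge 0$, then $\psi^*$ and $v^*$ are (weakly) increasing in $\mu$. -/

import Mathlib

open MeasureTheory ProbabilityTheory Set
open scoped NNReal

noncomputable section

/-! ### Optimal stopping of a time-homogeneous Markov process -/

namespace OptStop

variable {Z : Type*} [MeasurableSpace Z]

/-- The law `P_z` on the canonical sequence space `ℕ → Z` of the time-homogeneous Markov process
with stochastic kernel `P` started at `Z₀ = z`. -/
def pathLaw (P : Kernel Z Z) [IsMarkovKernel P] (z : Z) : Measure (ℕ → Z) :=
  Kernel.traj (X := fun _ => Z)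
    (fun n => P.comap (fun x : (i : Finset.Iic n) → Z => x ⟨n, Finset.mem_Iic.2 le_rfl⟩)
      (measurable_pi_apply _)) 0 (fun _ => z)

/-- Stopping times of the filtration generated by the coordinate process. The value `⊤` means
that the agent never stops. -/
def IsStopping (τ : (ℕ → Z) → WithTop ℕ) : Prop :=
  IsStoppingTime (Filtration.piLE (X := fun _ : ℕ => Z)) τ

/-- Realized payoff `∑_{t < τ} β^t c(Z_t) + β^τ r(Z_τ)`; on `{τ = ∞}` it is `∑_t β^t c(Z_t)`. -/
def payoff (β : ℝ) (r c : Z → ℝ) (τ : (ℕ → Z) → WithTop ℕ) (ω : ℕ → Z) : ℝ :=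
  match τ ω with
  | none => ∑' t : ℕ, β ^ t * c (ω t)
  | some n => (∑ t ∈ Finset.range n, β ^ t * c (ω t)) + β ^ n * r (ω n)

/-- Expected payoff `E_z` of the stopping time `τ`. -/
def expPayoff (P : Kernel Z Z) [IsMarkovKernel P] (β : ℝ) (r c : Z → ℝ)
    (τ : (ℕ → Z) → WithTop ℕ) (z : Z) : ℝ :=
  ∫ ω, payoff β r c τ ω ∂(pathLaw P z)

/-- The expected payoffs from `z` of all (almost surely) finite stopping times. -/
def finitePayoffs (P : Kernel Z Z) [IsMarkovKernel P] (β : ℝ) (r c : Z → ℝ) (z : Z) : Set ℝ :=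
  {x | ∃ τ : (ℕ → Z) → WithTop ℕ, IsStopping τ ∧ (∀ᵐ ω ∂(pathLaw P z), τ ω ≠ ⊤) ∧
    expPayoff P β r c τ z = x}

/-- The value function: the supremum of the expected payoff over the finite stopping times. -/
def value (P : Kernel Z Z) [IsMarkovKernel P] (β : ℝ) (r c : Z → ℝ) (z : Z) : ℝ :=
  sSup (finitePayoffs P β r c z)

/-- The time `inf {t ≥ 0 | σ(Z_t) = 1}` at which the policy `σ` stops (`1` means stop), equal to
`⊤` if the policy never stops. -/
def policyTime (σ : Z → Fin 2) (ω : ℕ → Z) : WithTop ℕ :=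
  sInf {s : ℕ∞ | ∃ t : ℕ, s = t ∧ σ (ω t) = 1}

/-- The policy `σ` is optimal: the time at which it stops is a stopping time which, from every
initial state, attains the value and is not improved upon by any stopping time, finite or not. -/
def IsOptimalPolicy (P : Kernel Z Z) [IsMarkovKernel P] (β : ℝ) (r c : Z → ℝ)
    (σ : Z → Fin 2) : Prop :=
  IsStopping (policyTime σ) ∧
    ∀ z, expPayoff P β r c (policyTime σ) z = value P β r c z ∧
      ∀ τ : (ℕ → Z) → WithTop ℕ, IsStopping τ →
        expPayoff P β r c τ z ≤ expPayoff P β r c (policyTime σ) z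

/-- The `κ`-weighted supremum norm. -/
def weightedNorm {S : Type*} (κ f : S → ℝ) : ℝ := ⨆ s, |f s| / κ s

/-- The space of measurable functions whose `κ`-weighted supremum norm is finite. -/
def weightedSpace {S : Type*} [MeasurableSpace S] (κ : S → ℝ) : Set (S → ℝ) :=
  {f | Measurable f ∧ BddAbove (range fun s => |f s| / κ s)}

end OptStop

/-! ### The firm entry problem -/

/-- Data of the firm entry problem: discount factor `β`, risk aversion `a`, autoregression
coefficient `ρ` of the persistent component `ξ_t = ρ ξ_{t-1} + N(0, γξ)`, variance `γx` of the
transitory component of the dividend `x_t = ξ_t + N(0, γx)`, noise variance `γy` of the signal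
`y_t = ξ_t + N(0, γy)`, and common law `h` on `(0, ∞)` of the i.i.d. investment costs. -/
structure FirmEntry where
  β : ℝ
  a : ℝ
  ρ : ℝ
  γx : ℝ≥0
  γξ : ℝ≥0
  γy : ℝ≥0
  h : Measure (Ioi (0 : ℝ))
  β_pos : 0 < β
  β_lt_one : β < 1
  a_pos : 0 < a
  noise_pos : 0 < γξ + γy
  prob_h : IsProbabilityMeasure h
  mean_h : Integrable (fun f : Ioi (0 : ℝ) => (f : ℝ)) h

namespace FirmEntry

open OptStop

attribute [instance] prob_h

/-- Threshold states: investment costs `f > 0`. -/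
abbrev X : Type := Ioi (0 : ℝ)

/-- Environment states: beliefs `(μ, γ)`, meaning `ξ ∼ N(μ, γ)`, with `γ > 0`. -/
abbrev Y : Type := ℝ × Ioi (0 : ℝ)

/-- States `(f, (μ, γ))`. -/
abbrev Z : Type := X × Y

variable (M : FirmEntry)

/-- CARA utility. -/
def u (x : ℝ) : ℝ := (1 - Real.exp (-M.a * x)) / M.a

/-- Law of the dividend `x = ξ + ε` with independent `ξ ∼ N(μ, γ)` and `ε ∼ N(0, γx)`. -/
def dividendLaw (y : Y) : Measure ℝ :=
  (gaussianReal y.1 (y.2 : ℝ).toNNReal).conv (gaussianReal 0 M.γx)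

/-- `E_{μ,γ}[u(x)]`. -/
def expUtility (y : Y) : ℝ := ∫ x, M.u x ∂(M.dividendLaw y)

/-- Exit payoff `r(f, μ, γ) = E_{μ,γ}[u(x)] - f`. -/
def r (z : Z) : ℝ := M.expUtility z.2 - (z.1 : ℝ)

/-- The flow continuation payoff vanishes. -/
def c (_ : Z) : ℝ := 0

/-- Predictive law `N(ρ μ, ρ² γ + γξ + γy)` of the next signal. -/
def signalLaw (y : Y) : Measure ℝ :=
  gaussianReal (M.ρ * y.1) (M.ρ ^ 2 * (y.2 : ℝ) + M.γξ + M.γy).toNNReal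

/-- Posterior variance `γ' = [1/γ + ρ²/(γξ + γy)]⁻¹`. -/
def postVar (γ : Ioi (0 : ℝ)) : Ioi (0 : ℝ) :=
  ⟨(1 / (γ : ℝ) + M.ρ ^ 2 / ((M.γξ : ℝ) + M.γy))⁻¹, by
    have h1 : (0 : ℝ) < γ := γ.2
    exact mem_Ioi.2 (inv_pos.2 (by positivity))⟩

/-- Posterior mean `μ' = γ' [μ/γ + ρ s/(γξ + γy)]` after the signal `s`. -/
def postMean (y : Y) (s : ℝ) : ℝ :=
  (M.postVar y.2 : ℝ) * (y.1 / (y.2 : ℝ) + M.ρ * s / ((M.γξ : ℝ) + M.γy))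

/-- The next state `(f', μ', γ')`, given the belief, the new cost `f'` and the new signal `s`. -/
def nextState (y : Y) (p : X × ℝ) : Z := (p.1, (M.postMean y p.2, M.postVar y.2))

theorem measurable_postVar : Measurable M.postVar := by
  unfold postVar
  fun_prop

theorem measurable_nextState : Measurable fun q : Y × (X × ℝ) => M.nextState q.1 q.2 := by
  have := M.measurable_postVar
  unfold nextState postMean
  fun_prop

theorem measurable_signalLaw : Measurable M.signalLaw := by
  have h1 : Measurable fun y : Y =>
      (M.ρ * y.1, (M.ρ ^ 2 * (y.2 : ℝ) + M.γξ + M.γy).toNNReal) := by fun_prop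
  exact measurable_gaussianReal.comp h1

/-- Conditional law of the next state given the belief: `f' ∼ h` and the signal
`s ∼ N(ρ μ, ρ² γ + γξ + γy)` are independent, and the belief is updated. -/
def envKernel : Kernel Y Z where
  toFun y := (M.h.prod (M.signalLaw y)).map (M.nextState y)
  measurable' := by
    let S : Kernel Y ℝ := ⟨M.signalLaw, M.measurable_signalLaw⟩
    have : IsMarkovKernel S := ⟨fun y => by
      change IsProbabilityMeasure (gaussianReal _ _); infer_instance⟩
    have key : (fun y => (M.h.prod (M.signalLaw y)).map (M.nextState y)) =
        ⇑((Kernel.id ×ₖ ((Kernel.const Y M.h) ×ₖ S)).map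
          fun q : Y × (X × ℝ) => M.nextState q.1 q.2) := by
      funext y
      rw [Kernel.map_apply _ M.measurable_nextState, Kernel.prod_apply, Kernel.prod_apply,
        Kernel.id_apply, Kernel.const_apply, Measure.dirac_prod,
        Measure.map_map M.measurable_nextState (by fun_prop)]
      rfl
    rw [key]
    exact Kernel.measurable _

instance : IsMarkovKernel M.envKernel := ⟨fun y => by
  change IsProbabilityMeasure ((M.h.prod (gaussianReal _ _)).map (M.nextState y))
  exact Measure.isProbabilityMeasure_map
    (M.measurable_nextState.comp measurable_prodMk_left).aemeasurable⟩

/-- The stochastic kernel of the state process: it depends on the belief only. -/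
def P : Kernel Z Z := M.envKernel.comap Prod.snd measurable_snd

instance : IsMarkovKernel M.P := by
  unfold P
  infer_instance

/-- The value function `v*`. -/
def vStar (z : Z) : ℝ := value M.P M.β M.r c z

/-- The continuation value function `ψ*(μ, γ) = β ∫ v* dP`. -/
def ψStar (y : Y) : ℝ := M.β * ∫ z', M.vStar z' ∂(M.envKernel y)

/-- The continuation value operator
`Qψ(μ, γ) = β ∫ max {E_{μ',γ'}[u(x')] - f', ψ(μ', γ')} dP`. -/
def Q (ψ : Y → ℝ) (y : Y) : ℝ := M.β * ∫ z', max (M.r z') (ψ z'.2) ∂(M.envKernel y)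

/-- The weight function `ℓ(μ, γ) = exp(-a μ + a² γ / 2) + d'`. -/
def weight (d' : ℝ) (y : Y) : ℝ := Real.exp (-M.a * y.1 + M.a ^ 2 * (y.2 : ℝ) / 2) + d'

/-- `f̄` is a reservation cost: at the cost `f̄(μ, γ)` the firm is indifferent between entering and
waiting. The threshold is allowed to be nonpositive, in which case the firm never enters. -/
def IsReservationCost (fbar : Y → ℝ) : Prop :=
  ∀ y, M.expUtility y - fbar y = M.ψStar y

/-- The reservation policy `1{f ≤ f̄(μ, γ)}`. -/
def reservationPolicy (fbar : Y → ℝ) (z : Z) : Fin 2 :=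
  open Classical in if (z.1 : ℝ) ≤ fbar z.2 then 1 else 0

end FirmEntry

end

/-! The proof joins a verification theorem for discounted stopping with a probabilistic fact about
Gaussian learning.

Verification: let `V = max (r, β P V)`, with `r` and `V` dominated by a weight `W` such that `P W ≤
K W` and `β K < 1`. Follow a stopping time `τ` up to date `N` and collect `V` at `N` if still
waiting. The expected amount `valueAt` equals `V z` at `N = 0`, is nonincreasing in `N` by the
Bellman equation, and tends to the payoff of `τ`, because the terminal term is at most `(β K) ^ N *
W z`. So no `τ` earns more than `V z`. If `τ` stops exactly when `r` is at least the continuation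
value, `valueAt` is constant and `V z` is attained (`expPayoff_le`, `expPayoff_eq`). That time may
be infinite; its truncations show that finite times have the same supremum (`isLUB_finitePayoffs`).

Learning: the posterior mean is `μ` plus a loading times a standard normal shock, and the squared
loading is the drop in variance `γ - γ'` (`loading_sq`). Hence `exp (-a μ + a² γ / 2)` is a
martingale and the weight is invariant under the kernel (`integral_weight`), so `Q` contracts with
modulus exactly `β`. As the shock law does not depend on the belief, `Q` preserves continuity (by
domination) and monotonicity in `μ` (shock by shock). Iterating `Q` from `0` gives a fixed point
with both properties; `max (r, ψ)` then solves the Bellman equation, which identifies `ψ` with the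
continuation value. -/

noncomputable section

/-! ### The Markov property of the path law. -/

namespace OptStop

open Filter Topology Preorder

variable {Z : Type*} [MeasurableSpace Z]

instance (P : Kernel Z Z) [IsMarkovKernel P] (z : Z) : IsProbabilityMeasure (pathLaw P z) := by
  unfold pathLaw
  infer_instance

/-- The transition kernel from the history up to time `n` to the state at time `n + 1`. -/
def historyKernel (P : Kernel Z Z) (n : ℕ) : Kernel (Finset.Iic n → Z) Z :=
  P.comap (fun x : (i : Finset.Iic n) → Z => x ⟨n, Finset.mem_Iic.2 le_rfl⟩)
      (measurable_pi_apply _)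

instance (P : Kernel Z Z) [IsMarkovKernel P] (n : ℕ) : IsMarkovKernel (historyKernel P n) := by
  unfold historyKernel
  infer_instance

variable (P : Kernel Z Z)

section

variable [IsMarkovKernel P]

/-- The Ionescu-Tulcea construction disintegrates the path law over the history. The one-step Markov
identities below are read off from this one. -/
theorem pathLaw_compProd_historyKernel (z : Z) (n : ℕ) :
    ((pathLaw P z).map (frestrictLe n)) ⊗ₘ (historyKernel P n) =
      (pathLaw P z).map (fun ω => (frestrictLe n ω, ω (n + 1))) := by
  have h := Kernel.partialTraj_compProd_eq_map_traj (X := fun _ => Z) (κ := historyKernel P)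
    (Nat.zero_le n) (x₀ := fun _ => z)
  rw [← Kernel.traj_map_frestrictLe_apply] at h
  exact h

theorem map_eval_zero_pathLaw (z : Z) :
    (pathLaw P z).map (fun ω => ω 0) = Measure.dirac z := by
  have h := Kernel.traj_map_frestrictLe_apply (X := fun _ => Z) (κ := historyKernel P) 0 0
    (fun _ => z)
  rw [Kernel.partialTraj_self, Kernel.id_apply] at h
  have h2 : (fun ω : ℕ → Z => ω 0) =
      (fun x : Finset.Iic 0 → Z => x ⟨0, Finset.mem_Iic.2 le_rfl⟩) ∘ frestrictLe 0 := rfl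
  rw [h2, ← Measure.map_map (by fun_prop) (by fun_prop)]
  change Measure.map _ (Measure.map _ (Kernel.traj (X := fun _ => Z) (historyKernel P) 0
    (fun _ => z))) = _
  rw [h, Measure.map_dirac' (by fun_prop)]

theorem lintegral_pathLaw_succ (z : Z) (n : ℕ) {g : Z → ENNReal} (hg : Measurable g) :
    ∫⁻ ω, g (ω (n + 1)) ∂(pathLaw P z) = ∫⁻ ω, ∫⁻ z', g z' ∂(P (ω n)) ∂(pathLaw P z) := by
  have hF : Measurable (fun ω : ℕ → Z => (frestrictLe (π := fun _ => Z) n ω, ω (n + 1))) := by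
    fun_prop
  have hm : Measurable fun x => ∫⁻ z', g z' ∂(historyKernel P n x) := hg.lintegral_kernel
  calc ∫⁻ ω, g (ω (n + 1)) ∂(pathLaw P z)
      = ∫⁻ p, g p.2 ∂(((pathLaw P z).map (frestrictLe n)) ⊗ₘ (historyKernel P n)) := by
        rw [pathLaw_compProd_historyKernel, lintegral_map (by fun_prop) hF]
    _ = _ := by
        rw [Measure.lintegral_compProd (by fun_prop), lintegral_map hm (by fun_prop)]
        rfl

/-- An event known at time `n` is the preimage of a set `t` of histories, so the claim is Fubini for
the composition product on `t ×ˢ univ`. -/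
theorem setIntegral_pathLaw_succ (z : Z) (n : ℕ) {g : Z → ℝ} (hg : Measurable g)
    (hint : Integrable (fun ω : ℕ → Z => g (ω (n + 1))) (pathLaw P z))
    {A : Set (ℕ → Z)} (hA : MeasurableSet[Filtration.piLE (X := fun _ : ℕ => Z) n] A) :
    ∫ ω in A, g (ω (n + 1)) ∂(pathLaw P z) =
      ∫ ω in A, ∫ z', g z' ∂(P (ω n)) ∂(pathLaw P z) := by
  rw [Filtration.piLE_eq_comap_frestrictLe] at hA
  obtain ⟨t, ht, rfl⟩ := hA
  have hF : Measurable (fun ω : ℕ → Z => (frestrictLe (π := fun _ => Z) n ω, ω (n + 1))) := by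
    fun_prop
  have hg2 : StronglyMeasurable fun p : (Finset.Iic n → Z) × Z => g p.2 :=
    (hg.comp measurable_snd).stronglyMeasurable
  have hI : Integrable (fun p : (Finset.Iic n → Z) × Z => g p.2)
      (((pathLaw P z).map (frestrictLe n)) ⊗ₘ (historyKernel P n)) := by
    rw [pathLaw_compProd_historyKernel,
      integrable_map_measure hg2.aestronglyMeasurable hF.aemeasurable]
    exact hint
  have h := Measure.setIntegral_compProd ht MeasurableSet.univ hI.integrableOn
  rw [pathLaw_compProd_historyKernel, setIntegral_map (ht.prod .univ) hg2.aestronglyMeasurable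
    hF.aemeasurable, setIntegral_map ht _ (by fun_prop)] at h
  · simp only [Measure.restrict_univ] at h
    convert h using 2
    · congr 1
      ext ω
      simp
    · rfl
  · simp only [Measure.restrict_univ]
    exact ((hg.comp measurable_snd).stronglyMeasurable.integral_kernel_prod_right'
      (κ := historyKernel P n)).aestronglyMeasurable

end

/-! ### Bellman solutions dominated by a weight with controlled drift. -/

/-- `V` solves the Bellman equation `V = max (r, β P V)` of the stopping problem with exit payoff
`r`, and `r` and `V` are dominated by a weight `W` satisfying the drift condition `P W ≤ K W` with
`β K < 1`. -/
structure IsBellmanSolution (β : ℝ) (r W V : Z → ℝ) (K : ℝ) : Prop where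
  discount_nonneg : 0 ≤ β
  drift_nonneg : 0 ≤ K
  contract : β * K < 1
  measurable_r : Measurable r
  measurable_W : Measurable W
  measurable_V : Measurable V
  abs_r_le : ∀ z, |r z| ≤ W z
  abs_V_le : ∀ z, |V z| ≤ W z
  drift : ∀ z, ∫⁻ z', ENNReal.ofReal (W z') ∂(P z) ≤ ENNReal.ofReal (K * W z)
  bellman : ∀ z, V z = max (r z) (β * ∫ z', V z' ∂(P z))

namespace IsBellmanSolution

variable {P} {β : ℝ} {r W V : Z → ℝ} {K : ℝ}

theorem W_nonneg (H : IsBellmanSolution P β r W V K) (z : Z) : 0 ≤ W z :=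
  (abs_nonneg _).trans (H.abs_r_le z)

/-- The discounted sum of the weights along a path. -/
def bound (β : ℝ) (W : Z → ℝ) (ω : ℕ → Z) : ENNReal :=
  ∑' n, ENNReal.ofReal (β ^ n * W (ω n))

theorem measurable_bound (H : IsBellmanSolution P β r W V K) : Measurable (bound β W) := by
  have := H.measurable_W
  exact Measurable.tsum fun n => by fun_prop

variable [IsMarkovKernel P]

theorem lintegral_W_le (H : IsBellmanSolution P β r W V K) (z : Z) (n : ℕ) :
    ∫⁻ ω, ENNReal.ofReal (W (ω n)) ∂(pathLaw P z) ≤ ENNReal.ofReal (K ^ n * W z) := by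
  have hW : Measurable fun z => ENNReal.ofReal (W z) := H.measurable_W.ennreal_ofReal
  induction n with
  | zero =>
    have := lintegral_map (μ := pathLaw P z) hW (measurable_pi_apply 0)
    rw [← this, map_eval_zero_pathLaw, lintegral_dirac' _ hW]
    simp
  | succ n ih =>
    rw [lintegral_pathLaw_succ P z n hW]
    calc _ ≤ ∫⁻ ω, ENNReal.ofReal K * ENNReal.ofReal (W (ω n)) ∂(pathLaw P z) := by
          refine lintegral_mono fun ω => (H.drift _).trans_eq ?_
          rw [ENNReal.ofReal_mul H.drift_nonneg]
      _ = ENNReal.ofReal K * ∫⁻ ω, ENNReal.ofReal (W (ω n)) ∂(pathLaw P z) :=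
          lintegral_const_mul _ (hW.comp (measurable_pi_apply n))
      _ ≤ ENNReal.ofReal K * ENNReal.ofReal (K ^ n * W z) := by gcongr
      _ = _ := by rw [← ENNReal.ofReal_mul H.drift_nonneg]; ring_nf

theorem integrable_W (H : IsBellmanSolution P β r W V K) (z : Z) (n : ℕ) :
    Integrable (fun ω : ℕ → Z => W (ω n)) (pathLaw P z) := by
  refine ⟨(H.measurable_W.comp (measurable_pi_apply n)).aestronglyMeasurable, ?_⟩
  rw [hasFiniteIntegral_iff_ofReal (ae_of_all _ fun ω => H.W_nonneg _)]
  exact (H.lintegral_W_le z n).trans_lt ENNReal.ofReal_lt_top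

theorem integral_W_le (H : IsBellmanSolution P β r W V K) (z : Z) (n : ℕ) :
    ∫ ω, W (ω n) ∂(pathLaw P z) ≤ K ^ n * W z := by
  have h0 : 0 ≤ K ^ n * W z := mul_nonneg (pow_nonneg H.drift_nonneg n) (H.W_nonneg z)
  rw [← ENNReal.ofReal_le_ofReal_iff h0, ofReal_integral_eq_lintegral_ofReal (H.integrable_W z n)
    (ae_of_all _ fun ω => H.W_nonneg _)]
  exact H.lintegral_W_le z n

/-- Iterating the drift condition bounds the expected terms by a geometric series of ratio `β K`.
This makes `bound` an integrable majorant for the payoffs of all stopping times at once. -/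
theorem lintegral_bound_ne_top (H : IsBellmanSolution P β r W V K) (z : Z) :
    ∫⁻ ω, bound β W ω ∂(pathLaw P z) ≠ ⊤ := by
  have hW := H.measurable_W
  unfold bound
  rw [lintegral_tsum fun n => Measurable.aemeasurable (by fun_prop)]
  have h : ∀ n, ∫⁻ ω, ENNReal.ofReal (β ^ n * W (ω n)) ∂(pathLaw P z) ≤
      ENNReal.ofReal ((β * K) ^ n * W z) := fun n => by
    simp_rw [ENNReal.ofReal_mul (pow_nonneg H.discount_nonneg n)]
    rw [lintegral_const_mul _ (by fun_prop)]
    calc _ ≤ ENNReal.ofReal (β ^ n) * ENNReal.ofReal (K ^ n * W z) := by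
          gcongr; exact H.lintegral_W_le z n
      _ = _ := by
          rw [← ENNReal.ofReal_mul (pow_nonneg H.discount_nonneg n), mul_pow, mul_assoc]
  have hq : 0 ≤ β * K := mul_nonneg H.discount_nonneg H.drift_nonneg
  refine ((ENNReal.tsum_le_tsum h).trans_lt ?_).ne
  rw [← ENNReal.ofReal_tsum_of_nonneg
    (fun n => mul_nonneg (pow_nonneg hq n) (H.W_nonneg z))
    ((summable_geometric_of_lt_one hq H.contract).mul_right _)]
  exact ENNReal.ofReal_lt_top

theorem integrable_bound (H : IsBellmanSolution P β r W V K) (z : Z) :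
    Integrable (fun ω => (bound β W ω).toReal) (pathLaw P z) :=
  integrable_toReal_of_lintegral_ne_top H.measurable_bound.aemeasurable
    (H.lintegral_bound_ne_top z)

theorem ae_le_bound (H : IsBellmanSolution P β r W V K) (z : Z) :
    ∀ᵐ ω ∂(pathLaw P z), ∀ n, β ^ n * W (ω n) ≤ (bound β W ω).toReal := by
  filter_upwards [ae_lt_top H.measurable_bound (H.lintegral_bound_ne_top z)] with ω hω n
  rw [← ENNReal.ofReal_le_iff_le_toReal hω.ne]
  exact ENNReal.le_tsum n

end IsBellmanSolution

end OptStop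

/-! ### Truncated payoffs and measurability of stopping events. -/

namespace OptStop

open Filter Topology

variable {Z : Type*}

/-- Payoff of `τ` collected strictly before time `N`. -/
def payoffBefore (β : ℝ) (r : Z → ℝ) (τ : (ℕ → Z) → WithTop ℕ) (N : ℕ) (ω : ℕ → Z) : ℝ :=
  ∑ n ∈ Finset.range N, {ω | τ ω = n}.indicator (fun ω => β ^ n * r (ω n)) ω

section Payoff

variable {β : ℝ} {r : Z → ℝ} {τ : (ℕ → Z) → WithTop ℕ} {ω : ℕ → Z}

theorem payoff_of_eq_coe {n : ℕ} (h : τ ω = n) :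
    payoff β r (fun _ => 0) τ ω = β ^ n * r (ω n) := by
  unfold payoff
  rw [h]
  change (∑ t ∈ Finset.range n, β ^ t * 0) + β ^ n * r (ω n) = _
  simp

theorem payoff_of_eq_top (h : τ ω = ⊤) : payoff β r (fun _ => 0) τ ω = 0 := by
  unfold payoff
  rw [h]
  change ∑' t : ℕ, β ^ t * 0 = 0
  simp

theorem payoffBefore_of_lt {n N : ℕ} (h : τ ω = n) (hn : n < N) :
    payoffBefore β r τ N ω = β ^ n * r (ω n) := by
  unfold payoffBefore
  rw [Finset.sum_eq_single n]
  · simp [h]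
  · intro m _ hm
    simp [h, Ne.symm hm]
  · simp [hn]

theorem payoffBefore_of_le {N : ℕ} (h : (N : WithTop ℕ) ≤ τ ω) :
    payoffBefore β r τ N ω = 0 := by
  unfold payoffBefore
  refine Finset.sum_eq_zero fun m hm => Set.indicator_of_notMem (fun h' => ?_) _
  exact absurd (Finset.mem_range.1 hm) (not_lt.2 (WithTop.coe_le_coe.1 (h.trans (le_of_eq h'))))

theorem tendsto_payoffBefore (β : ℝ) (r : Z → ℝ) (τ : (ℕ → Z) → WithTop ℕ) (ω : ℕ → Z) :
    Tendsto (fun N => payoffBefore β r τ N ω) atTop (𝓝 (payoff β r (fun _ => 0) τ ω)) := by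
  induction h : τ ω using WithTop.recTopCoe with
  | top =>
    rw [payoff_of_eq_top h]
    simp [payoffBefore_of_le (N := _) (show _ ≤ τ ω by rw [h]; exact le_top)]
  | coe n =>
    rw [payoff_of_eq_coe h]
    refine tendsto_const_nhds.congr' ?_
    filter_upwards [eventually_gt_atTop n] with N hN
    exact (payoffBefore_of_lt h hN).symm

end Payoff

theorem coe_succ_le_iff (n : ℕ) (t : WithTop ℕ) :
    ((n + 1 : ℕ) : WithTop ℕ) ≤ t ↔ (n : WithTop ℕ) < t := by
  induction t using WithTop.recTopCoe with
  | top => exact iff_of_true le_top (WithTop.coe_lt_top n)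
  | coe m => exact WithTop.coe_le_coe.trans (Nat.succ_le_iff.trans WithTop.coe_lt_coe.symm)

variable [MeasurableSpace Z]

theorem IsStopping.measurableSet_lt {τ : (ℕ → Z) → WithTop ℕ} (hτ : IsStopping τ) (n : ℕ) :
    MeasurableSet[Filtration.piLE (X := fun _ : ℕ => Z) n] {ω | (n : WithTop ℕ) < τ ω} := by
  have h := (hτ n).compl
  convert h using 1
  ext ω
  simp

theorem IsStopping.measurableSet_le {τ : (ℕ → Z) → WithTop ℕ} (hτ : IsStopping τ) (n : ℕ) :
    MeasurableSet {ω | (n : WithTop ℕ) ≤ τ ω} := by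
  cases n with
  | zero => simp
  | succ n =>
    have h := Filtration.le _ _ _ (hτ.measurableSet_lt n)
    convert h using 1
    exact Set.ext fun ω => coe_succ_le_iff n (τ ω)

theorem IsStopping.measurableSet_eq_coe {τ : (ℕ → Z) → WithTop ℕ} (hτ : IsStopping τ) (n : ℕ) :
    MeasurableSet {ω | τ ω = n} := by
  have h := (hτ.measurableSet_le n).inter (Filtration.le _ _ _ (hτ n))
  convert h using 1
  ext ω
  exact ⟨fun h => ⟨ge_of_eq h, le_of_eq h⟩, fun h => le_antisymm h.2 h.1⟩

theorem IsStopping.measurable_payoffBefore {τ : (ℕ → Z) → WithTop ℕ} (hτ : IsStopping τ)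
    (β : ℝ) {r : Z → ℝ} (hr : Measurable r) (N : ℕ) : Measurable (payoffBefore β r τ N) := by
  unfold payoffBefore
  exact Finset.measurable_fun_sum _ fun n _ =>
    Measurable.indicator (by fun_prop) (hτ.measurableSet_eq_coe n)

/-! ### The supermartingale argument. -/

namespace IsBellmanSolution

variable {P : Kernel Z Z} [IsMarkovKernel P] {β : ℝ} {r W V : Z → ℝ} {K : ℝ}

theorem ae_abs_payoffBefore_le (H : IsBellmanSolution P β r W V K) (z : Z)
    (τ : (ℕ → Z) → WithTop ℕ) :
    ∀ᵐ ω ∂(pathLaw P z), ∀ N, ‖payoffBefore β r τ N ω‖ ≤ (bound β W ω).toReal := by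
  filter_upwards [H.ae_le_bound z] with ω hω N
  by_cases h : (N : WithTop ℕ) ≤ τ ω
  · rw [payoffBefore_of_le h]; simp
  · rw [not_le] at h
    obtain ⟨n, hn⟩ := WithTop.ne_top_iff_exists.1 h.ne_top
    rw [payoffBefore_of_lt (N := N) hn.symm (WithTop.coe_lt_coe.1 (hn.trans_lt h)),
      Real.norm_eq_abs, abs_mul,
      abs_of_nonneg (pow_nonneg H.discount_nonneg n)]
    exact (mul_le_mul_of_nonneg_left (H.abs_r_le _) (pow_nonneg H.discount_nonneg n)).trans (hω n)

theorem integrable_payoff (H : IsBellmanSolution P β r W V K) (z : Z)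
    {τ : (ℕ → Z) → WithTop ℕ} (hτ : IsStopping τ) :
    Integrable (payoff β r (fun _ => 0) τ) (pathLaw P z) := by
  refine (H.integrable_bound z).mono' ?_ ?_
  · exact (measurable_of_tendsto_metrizable (hτ.measurable_payoffBefore β H.measurable_r)
      (tendsto_pi_nhds.2 (tendsto_payoffBefore β r τ))).aestronglyMeasurable
  · filter_upwards [H.ae_abs_payoffBefore_le z τ] with ω hω
    exact le_of_tendsto (tendsto_payoffBefore β r τ ω).norm (Eventually.of_forall hω)

theorem integrable_payoffBefore (H : IsBellmanSolution P β r W V K) (z : Z)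
    {τ : (ℕ → Z) → WithTop ℕ} (hτ : IsStopping τ) (N : ℕ) :
    Integrable (payoffBefore β r τ N) (pathLaw P z) :=
  (H.integrable_bound z).mono' (hτ.measurable_payoffBefore β H.measurable_r N).aestronglyMeasurable
    ((H.ae_abs_payoffBefore_le z τ).mono fun _ h => h N)

theorem tendsto_integral_payoffBefore (H : IsBellmanSolution P β r W V K) (z : Z)
    {τ : (ℕ → Z) → WithTop ℕ} (hτ : IsStopping τ) :
    Tendsto (fun N => ∫ ω, payoffBefore β r τ N ω ∂(pathLaw P z)) atTop
      (𝓝 (expPayoff P β r (fun _ => 0) τ z)) :=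
  tendsto_integral_of_dominated_convergence _
    (fun N => (hτ.measurable_payoffBefore β H.measurable_r N).aestronglyMeasurable)
    (H.integrable_bound z) (fun N => (H.ae_abs_payoffBefore_le z τ).mono fun _ h => h N)
    (ae_of_all _ (tendsto_payoffBefore β r τ))

theorem integrable_eval (H : IsBellmanSolution P β r W V K) (z : Z) (n : ℕ) {g : Z → ℝ}
    (hg : Measurable g) (hgW : ∀ z, |g z| ≤ W z) :
    Integrable (fun ω : ℕ → Z => g (ω n)) (pathLaw P z) :=
  (H.integrable_W z n).mono' (hg.comp (measurable_pi_apply n)).aestronglyMeasurable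
    (ae_of_all _ fun _ => hgW _)

/-- Terminal terms vanish at rate `(β K) ^ n` whatever the events. This is used both for `g = V`
(verification) and for `g = r` (truncated stopping times). -/
theorem tendsto_setIntegral_zero (H : IsBellmanSolution P β r W V K) (z : Z) {g : Z → ℝ}
    (hg : Measurable g) (hgW : ∀ z, |g z| ≤ W z) (A : ℕ → Set (ℕ → Z)) :
    Tendsto (fun n => ∫ ω in A n, β ^ n * g (ω n) ∂(pathLaw P z)) atTop (𝓝 0) := by
  have hq : 0 ≤ β * K := mul_nonneg H.discount_nonneg H.drift_nonneg
  refine squeeze_zero_norm (a := fun n => (β * K) ^ n * W z) (fun n => ?_) ?_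
  · have hβ := pow_nonneg H.discount_nonneg n
    calc ‖∫ ω in A n, β ^ n * g (ω n) ∂(pathLaw P z)‖
        ≤ ∫ ω in A n, ‖β ^ n * g (ω n)‖ ∂(pathLaw P z) := norm_integral_le_integral_norm _
      _ ≤ ∫ ω, ‖β ^ n * g (ω n)‖ ∂(pathLaw P z) :=
          setIntegral_le_integral ((H.integrable_eval z n hg hgW).const_mul _).norm
            (ae_of_all _ fun _ => norm_nonneg _)
      _ ≤ ∫ ω, β ^ n * W (ω n) ∂(pathLaw P z) := by
          refine integral_mono ((H.integrable_eval z n hg hgW).const_mul _).norm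
            ((H.integrable_W z n).const_mul _) fun ω => ?_
          simp only [norm_mul, Real.norm_eq_abs, abs_of_nonneg hβ]
          exact mul_le_mul_of_nonneg_left (hgW _) hβ
      _ = β ^ n * ∫ ω, W (ω n) ∂(pathLaw P z) := integral_const_mul _ _
      _ ≤ β ^ n * (K ^ n * W z) := mul_le_mul_of_nonneg_left (H.integral_W_le z n) hβ
      _ = _ := by rw [mul_pow, mul_assoc]
  · simpa using (tendsto_pow_atTop_nhds_zero_of_lt_one hq H.contract).mul_const (W z)

/-- Expected payoff when `τ` is followed before time `N`, and `V` is received at time `N` if the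
process has not been stopped. -/
def valueAt (P : Kernel Z Z) [IsMarkovKernel P] (β : ℝ) (r V : Z → ℝ) (τ : (ℕ → Z) → WithTop ℕ)
    (z : Z) (N : ℕ) : ℝ :=
  (∫ ω, payoffBefore β r τ N ω ∂(pathLaw P z)) +
    ∫ ω in {ω | (N : WithTop ℕ) ≤ τ ω}, β ^ N * V (ω N) ∂(pathLaw P z)

theorem valueAt_zero (H : IsBellmanSolution P β r W V K) (z : Z) (τ : (ℕ → Z) → WithTop ℕ) :
    valueAt P β r V τ z 0 = V z := by
  have h := integral_map (μ := pathLaw P z) (φ := fun ω => ω 0) (f := V)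
    (measurable_pi_apply 0).aemeasurable
    H.measurable_V.aestronglyMeasurable
  rw [map_eval_zero_pathLaw, integral_dirac' _ _ H.measurable_V.stronglyMeasurable] at h
  simp [valueAt, payoffBefore, ← h]

theorem tendsto_valueAt (H : IsBellmanSolution P β r W V K) (z : Z) {g : Z → ℝ}
    (hg : Measurable g) (hgW : ∀ z, |g z| ≤ W z)
    {τ : (ℕ → Z) → WithTop ℕ} (hτ : IsStopping τ) :
    Tendsto (valueAt P β r g τ z) atTop (𝓝 (expPayoff P β r (fun _ => 0) τ z)) := by
  have h := (H.tendsto_integral_payoffBefore z hτ).add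
    (H.tendsto_setIntegral_zero z hg hgW fun n => {ω | (n : WithTop ℕ) ≤ τ ω})
  rw [add_zero] at h
  exact h

/-- The event `n + 1 ≤ τ` is `n < τ`, which is decided by time `n`; the Markov property therefore
replaces `V` at `n + 1` by its conditional expectation. Stopping at exactly `n` is split off so that
the result can be compared termwise with `valueAt_eq`. -/
theorem valueAt_succ (H : IsBellmanSolution P β r W V K) (z : Z)
    {τ : (ℕ → Z) → WithTop ℕ} (hτ : IsStopping τ) (n : ℕ) :
    valueAt P β r V τ z (n + 1) = (∫ ω, payoffBefore β r τ n ω ∂(pathLaw P z)) +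
      ((∫ ω in {ω | τ ω = n}, β ^ n * r (ω n) ∂(pathLaw P z)) +
      ∫ ω in {ω | (n : WithTop ℕ) < τ ω},
        β ^ n * (β * ∫ z', V z' ∂(P (ω n))) ∂(pathLaw P z)) := by
  have h1 : {ω | ((n + 1 : ℕ) : WithTop ℕ) ≤ τ ω} = {ω | (n : WithTop ℕ) < τ ω} := by
    exact Set.ext fun ω => coe_succ_le_iff n (τ ω)
  have h2 : ∀ ω, payoffBefore β r τ (n + 1) ω = payoffBefore β r τ n ω +
      {ω | τ ω = n}.indicator (fun ω => β ^ n * r (ω n)) ω := fun ω =>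
    Finset.sum_range_succ _ _
  have h3 := (H.integrable_eval z n H.measurable_r H.abs_r_le).const_mul (β ^ n)
  unfold valueAt
  simp_rw [h1, h2]
  rw [integral_add (H.integrable_payoffBefore z hτ n)
    (h3.indicator (hτ.measurableSet_eq_coe n)), integral_indicator (hτ.measurableSet_eq_coe n),
    add_assoc]
  congr 2
  rw [integral_const_mul, setIntegral_pathLaw_succ P z n H.measurable_V
    (H.integrable_eval z _ H.measurable_V H.abs_V_le) (hτ.measurableSet_lt n),
    ← integral_const_mul]
  congr 1
  ext ω
  ring

omit [IsMarkovKernel P] in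
theorem measurable_integral (H : IsBellmanSolution P β r W V K) :
    Measurable fun z => ∫ z', V z' ∂(P z) :=
  (H.measurable_V.stronglyMeasurable.integral_kernel (κ := P)).measurable

omit [IsMarkovKernel P] in
theorem abs_continuation_le (H : IsBellmanSolution P β r W V K) (z : Z) :
    |β * ∫ z', V z' ∂(P z)| ≤ W z := by
  have h0 : Integrable W (P z) := by
    refine ⟨H.measurable_W.aestronglyMeasurable, ?_⟩
    rw [hasFiniteIntegral_iff_ofReal (ae_of_all _ fun z => H.W_nonneg _)]
    exact (H.drift z).trans_lt ENNReal.ofReal_lt_top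
  have h1 : ∫ z', W z' ∂(P z) ≤ K * W z := by
    rw [← ENNReal.ofReal_le_ofReal_iff (mul_nonneg H.drift_nonneg (H.W_nonneg z)),
      ofReal_integral_eq_lintegral_ofReal h0 (ae_of_all _ fun z => H.W_nonneg _)]
    exact H.drift z
  have h2 : |∫ z', V z' ∂(P z)| ≤ ∫ z', W z' ∂(P z) :=
    norm_integral_le_of_norm_le (f := V) h0 (ae_of_all _ H.abs_V_le)
  rw [abs_mul, abs_of_nonneg H.discount_nonneg]
  calc β * |∫ z', V z' ∂(P z)| ≤ β * (K * W z) :=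
        mul_le_mul_of_nonneg_left (h2.trans h1) H.discount_nonneg
    _ = (β * K) * W z := by ring
    _ ≤ W z := mul_le_of_le_one_left (H.W_nonneg z) H.contract.le

theorem valueAt_eq (H : IsBellmanSolution P β r W V K) (z : Z)
    {τ : (ℕ → Z) → WithTop ℕ} (hτ : IsStopping τ) (n : ℕ) :
    valueAt P β r V τ z n = (∫ ω, payoffBefore β r τ n ω ∂(pathLaw P z)) +
      ((∫ ω in {ω | τ ω = n}, β ^ n * V (ω n) ∂(pathLaw P z)) +
      ∫ ω in {ω | (n : WithTop ℕ) < τ ω}, β ^ n * V (ω n) ∂(pathLaw P z)) := by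
  have h1 : {ω | (n : WithTop ℕ) ≤ τ ω} = {ω | τ ω = n} ∪ {ω | (n : WithTop ℕ) < τ ω} := by
    ext ω
    simp only [mem_ofPred_eq, mem_union, le_iff_eq_or_lt, eq_comm]
  have h3 := (H.integrable_eval z n H.measurable_V H.abs_V_le).const_mul (β ^ n)
  unfold valueAt
  rw [h1, setIntegral_union _ (Filtration.le _ _ _ (hτ.measurableSet_lt n)) h3.integrableOn
    h3.integrableOn]
  rw [Set.disjoint_left]
  intro ω h h'
  exact absurd h.symm (ne_of_lt h')

/-- The two halves of the Bellman equation serve the two events: `r ≤ V` where `τ = n`, and `β P V ≤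
V` where `n < τ`. -/
theorem valueAt_succ_le (H : IsBellmanSolution P β r W V K) (z : Z)
    {τ : (ℕ → Z) → WithTop ℕ} (hτ : IsStopping τ) (n : ℕ) :
    valueAt P β r V τ z (n + 1) ≤ valueAt P β r V τ z n := by
  have hβ := pow_nonneg H.discount_nonneg n
  rw [H.valueAt_succ z hτ, H.valueAt_eq z hτ]
  refine add_le_add le_rfl (add_le_add (integral_mono ?_ ?_ ?_) (integral_mono ?_ ?_ ?_))
  · exact ((H.integrable_eval z n H.measurable_r H.abs_r_le).const_mul _).integrableOn
  · exact ((H.integrable_eval z n H.measurable_V H.abs_V_le).const_mul _).integrableOn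
  · intro ω
    exact mul_le_mul_of_nonneg_left ((H.bellman _).symm ▸ le_max_left _ _) hβ
  · exact ((H.integrable_eval z n (H.measurable_integral.const_mul β)
      H.abs_continuation_le).const_mul _).integrableOn
  · exact ((H.integrable_eval z n H.measurable_V H.abs_V_le).const_mul _).integrableOn
  · intro ω
    exact mul_le_mul_of_nonneg_left ((H.bellman _).symm ▸ le_max_right _ _) hβ

theorem expPayoff_le (H : IsBellmanSolution P β r W V K) (z : Z)
    {τ : (ℕ → Z) → WithTop ℕ} (hτ : IsStopping τ) :
    expPayoff P β r (fun _ => 0) τ z ≤ V z := by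
  rw [← H.valueAt_zero z τ]
  exact le_of_tendsto (H.tendsto_valueAt z H.measurable_V H.abs_V_le hτ)
    (Eventually.of_forall fun n => antitone_nat_of_succ_le (H.valueAt_succ_le z hτ) (Nat.zero_le n))

/-- Both inequalities of `valueAt_succ_le` become equalities, so `valueAt` is constant along `τ`. -/
theorem expPayoff_eq (H : IsBellmanSolution P β r W V K) (z : Z)
    {τ : (ℕ → Z) → WithTop ℕ} (hτ : IsStopping τ)
    (hexit : ∀ ω (n : ℕ), τ ω = n → V (ω n) = r (ω n))
    (hcont : ∀ ω (n : ℕ), (n : WithTop ℕ) < τ ω → V (ω n) = β * ∫ z', V z' ∂(P (ω n))) :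
    expPayoff P β r (fun _ => 0) τ z = V z := by
  have h : ∀ n, valueAt P β r V τ z n = V z := fun n => by
    induction n with
    | zero => exact H.valueAt_zero z τ
    | succ n ih =>
      rw [← ih, H.valueAt_succ z hτ, H.valueAt_eq z hτ]
      congr 2
      · exact setIntegral_congr_fun (hτ.measurableSet_eq_coe n) fun ω hω => by
          simp only [hexit ω n hω]
      · exact setIntegral_congr_fun (Filtration.le _ _ _ (hτ.measurableSet_lt n)) fun ω hω => by
          simp only [hcont ω n hω]
  refine tendsto_nhds_unique (H.tendsto_valueAt z H.measurable_V H.abs_V_le hτ) ?_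
  rw [show valueAt P β r V τ z = fun _ => V z from funext h]
  exact tendsto_const_nhds

/-- The payoff of `min τ N` is that of `τ` before `N`, plus the exit payoff at `N` on
`{N ≤ τ}`. -/
theorem expPayoff_min (H : IsBellmanSolution P β r W V K) (z : Z)
    {τ : (ℕ → Z) → WithTop ℕ} (hτ : IsStopping τ) (N : ℕ) :
    expPayoff P β r (fun _ => 0) (fun ω => min (τ ω) N) z = valueAt P β r r τ z N := by
  unfold valueAt expPayoff
  rw [← integral_indicator (hτ.measurableSet_le N), ← integral_add
    (H.integrable_payoffBefore z hτ N)
    (((H.integrable_eval z N H.measurable_r H.abs_r_le).const_mul _).indicator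
      (hτ.measurableSet_le N))]
  congr 1
  ext ω
  by_cases h : (N : WithTop ℕ) ≤ τ ω
  · rw [payoffBefore_of_le h, indicator_of_mem (by exact h), zero_add]
    exact payoff_of_eq_coe (min_eq_right h)
  · rw [indicator_of_notMem (by exact h), add_zero]
    rw [not_le] at h
    obtain ⟨n, hn⟩ := WithTop.ne_top_iff_exists.1 h.ne_top
    rw [payoffBefore_of_lt (N := N) hn.symm (WithTop.coe_lt_coe.1 (hn.trans_lt h))]
    exact payoff_of_eq_coe ((min_eq_left h.le).trans hn.symm)

/-- An optimal `τ` may be infinite with positive probability and so need not compete. The bounded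
times `min τ N` do, and their payoffs converge to that of `τ`, since the exit payoff forced at `N`
is asymptotically negligible. -/
theorem isLUB_finitePayoffs (H : IsBellmanSolution P β r W V K) (z : Z)
    {τ : (ℕ → Z) → WithTop ℕ} (hτ : IsStopping τ)
    (hopt : expPayoff P β r (fun _ => 0) τ z = V z) :
    IsLUB (finitePayoffs P β r (fun _ => 0) z) (V z) := by
  refine ⟨?_, fun b hb => ?_⟩
  · rintro x ⟨σ, hσ, -, rfl⟩
    exact H.expPayoff_le z hσ
  · rw [← hopt]
    refine le_of_tendsto (H.tendsto_valueAt z H.measurable_r H.abs_r_le hτ)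
      (Eventually.of_forall fun N => ?_)
    rw [← H.expPayoff_min z hτ]
    refine hb ⟨_, hτ.min_const N, ae_of_all _ fun ω => ?_, rfl⟩
    exact ((min_le_right _ _).trans_lt (WithTop.coe_lt_top N)).ne

end IsBellmanSolution

/-! ### Hitting times of policies and their optimality. -/

omit [MeasurableSpace Z] in
theorem policyTime_le_coe_iff (σ : Z → Fin 2) (ω : ℕ → Z) (n : ℕ) :
    policyTime σ ω ≤ (n : WithTop ℕ) ↔ ∃ t ≤ n, σ (ω t) = 1 := by
  constructor
  · intro h
    have hne : {s : ℕ∞ | ∃ t : ℕ, s = t ∧ σ (ω t) = 1}.Nonempty := by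
      by_contra h'
      have h2 : sInf {s : ℕ∞ | ∃ t : ℕ, s = t ∧ σ (ω t) = 1} = ⊤ := by
        rw [Set.not_nonempty_iff_eq_empty.1 h', sInf_empty]
      exact absurd ((ge_of_eq h2).trans h) (not_le.2 (WithTop.coe_lt_top n))
    obtain ⟨t, ht, ht'⟩ := csInf_mem hne
    exact ⟨t, WithTop.coe_le_coe.1 ((ge_of_eq ht).trans h), ht'⟩
  · rintro ⟨t, ht, ht'⟩
    refine le_trans (b := ((t : ℕ∞) : WithTop ℕ)) (sInf_le ⟨t, rfl, ht'⟩) (WithTop.coe_le_coe.2 ht)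

theorem isStopping_policyTime {σ : Z → Fin 2} (hσ : Measurable σ) :
    IsStopping (policyTime σ) := by
  intro n
  have : {ω | policyTime σ ω ≤ (n : WithTop ℕ)} = ⋃ t ∈ Iic n, {ω : ℕ → Z | σ (ω t) = 1} := by
    ext ω
    simp [policyTime_le_coe_iff]
  refine (congrArg (MeasurableSet[Filtration.piLE (X := fun _ : ℕ => Z) n]) this).mpr ?_
  refine MeasurableSet.biUnion (Set.to_countable _) fun t ht => ?_
  rw [Filtration.piLE_eq_comap_frestrictLe]
  exact ⟨(fun x : Finset.Iic n → Z => σ (x ⟨t, Finset.mem_Iic.2 ht⟩)) ⁻¹' {1},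
    (hσ.comp (measurable_pi_apply _)) (measurableSet_singleton _), rfl⟩

omit [MeasurableSpace Z] in
theorem policyTime_eq_coe {σ : Z → Fin 2} {ω : ℕ → Z} {n : ℕ} (h : policyTime σ ω = n) :
    σ (ω n) = 1 := by
  obtain ⟨t, ht, ht'⟩ := (policyTime_le_coe_iff σ ω n).1 h.le
  have h2 := (policyTime_le_coe_iff σ ω t).2 ⟨t, le_rfl, ht'⟩
  rwa [le_antisymm (WithTop.coe_le_coe.1 (h.symm.trans_le h2) : n ≤ t) ht]

omit [MeasurableSpace Z] in
theorem lt_policyTime {σ : Z → Fin 2} {ω : ℕ → Z} {n : ℕ} (h : n < policyTime σ ω) :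
    σ (ω n) ≠ 1 := fun h' =>
  absurd ((policyTime_le_coe_iff σ ω n).2 ⟨n, le_rfl, h'⟩) (not_le.2 h)

namespace IsBellmanSolution

variable {P : Kernel Z Z} [IsMarkovKernel P] {β : ℝ} {r W V : Z → ℝ} {K : ℝ}

theorem expPayoff_policyTime (H : IsBellmanSolution P β r W V K) {σ : Z → Fin 2}
    (hσm : Measurable σ) (hσ : ∀ z, σ z = 1 ↔ β * ∫ z', V z' ∂(P z) ≤ r z) (z : Z) :
    expPayoff P β r (fun _ => 0) (policyTime σ) z = V z := by
  refine H.expPayoff_eq z (isStopping_policyTime hσm) (fun ω n h => ?_) fun ω n h => ?_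
  · rw [H.bellman, max_eq_left ((hσ _).1 (policyTime_eq_coe h))]
  · rw [H.bellman, max_eq_right (le_of_not_ge fun h' => lt_policyTime h ((hσ _).2 h'))]

theorem value_eq (H : IsBellmanSolution P β r W V K) {σ : Z → Fin 2}
    (hσm : Measurable σ) (hσ : ∀ z, σ z = 1 ↔ β * ∫ z', V z' ∂(P z) ≤ r z) (z : Z) :
    value P β r (fun _ => 0) z = V z :=
  -- The real supremum needs a nonempty set; stopping at time `0` is the witness.
  (H.isLUB_finitePayoffs z (isStopping_policyTime hσm)
    (H.expPayoff_policyTime hσm hσ z)).csSup_eq ⟨_, 0, isStoppingTime_const _ 0,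
      ae_of_all _ fun _ => WithTop.zero_ne_top, rfl⟩

theorem isOptimalPolicy (H : IsBellmanSolution P β r W V K) {σ : Z → Fin 2}
    (hσm : Measurable σ) (hσ : ∀ z, σ z = 1 ↔ β * ∫ z', V z' ∂(P z) ≤ r z) :
    IsOptimalPolicy P β r (fun _ => 0) σ := by
  refine ⟨isStopping_policyTime hσm, fun z => ⟨?_, fun τ hτ => ?_⟩⟩
  · rw [H.expPayoff_policyTime hσm hσ, H.value_eq hσm hσ]
  · rw [H.expPayoff_policyTime hσm hσ]
    exact H.expPayoff_le z hτ

end IsBellmanSolution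

end OptStop

/-! ### Gaussian belief updating driven by a standard shock. -/

namespace FirmEntry

open OptStop Filter Topology

variable (M : FirmEntry)

/-- Law of the cost and of a standard normal shock to the belief. -/
def shockLaw : Measure (X × ℝ) := M.h.prod (gaussianReal 0 1)

instance : IsProbabilityMeasure M.shockLaw := by
  unfold shockLaw
  infer_instance

/-- Loading of the posterior mean on the standardized signal. -/
def loading (γ : Ioi (0 : ℝ)) : ℝ :=
  (M.postVar γ : ℝ) * M.ρ * √(M.ρ ^ 2 * (γ : ℝ) + M.γξ + M.γy) / (M.γξ + M.γy)

/-- The next state in terms of the cost and of the standardized signal. -/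
def step (y : Y) (p : X × ℝ) : Z := (p.1, (y.1 + M.loading y.2 * p.2, M.postVar y.2))

theorem noise_pos' : (0 : ℝ) < M.γξ + M.γy := by
  exact_mod_cast M.noise_pos

theorem signalVar_nonneg (γ : Ioi (0 : ℝ)) : 0 ≤ M.ρ ^ 2 * (γ : ℝ) + M.γξ + M.γy := by
  have : (0 : ℝ) ≤ γ := (mem_Ioi.1 γ.2).le
  positivity

theorem postVar_eq (γ : Ioi (0 : ℝ)) :
    (M.postVar γ : ℝ) = γ * (M.γξ + M.γy) / (M.γξ + M.γy + M.ρ ^ 2 * γ) := by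
  have h1 : (0 : ℝ) < γ := γ.2
  have h2 := M.noise_pos'
  have h3 : 0 < (M.γξ : ℝ) + M.γy + M.ρ ^ 2 * γ := by positivity
  change (1 / (γ : ℝ) + M.ρ ^ 2 / ((M.γξ : ℝ) + M.γy))⁻¹ = _
  rw [div_add_div _ _ h1.ne' h2.ne', inv_div]
  ring_nf

/-- The law of total variance: what the signal removes from the belief variance is the variance of
the posterior mean. -/
theorem loading_sq (γ : Ioi (0 : ℝ)) : M.loading γ ^ 2 = γ - M.postVar γ := by
  have h1 : (0 : ℝ) < γ := γ.2
  have h2 := M.noise_pos'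
  have h3 : 0 < (M.γξ : ℝ) + M.γy + M.ρ ^ 2 * γ := by positivity
  unfold loading
  rw [div_pow, mul_pow, Real.sq_sqrt (M.signalVar_nonneg γ), postVar_eq]
  field_simp
  ring

/-- At the predicted signal `ρ μ` the bracket is `μ` times the posterior precision, so the mean does
not move; only the standardized surprise shifts it. -/
theorem postMean_signal (y : Y) (x : ℝ) :
    M.postMean y (M.ρ * y.1 + √(M.ρ ^ 2 * (y.2 : ℝ) + M.γξ + M.γy) * x) =
      y.1 + M.loading y.2 * x := by
  have h1 : (0 : ℝ) < y.2 := y.2.2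
  have h2 := M.noise_pos'
  have h3 : 0 < (M.γξ : ℝ) + M.γy + M.ρ ^ 2 * (y.2 : ℝ) := by positivity
  unfold postMean loading
  generalize √(M.ρ ^ 2 * (y.2 : ℝ) + M.γξ + M.γy) = σ
  rw [postVar_eq]
  field_simp
  ring

theorem signalLaw_eq_map (y : Y) :
    M.signalLaw y = (gaussianReal 0 1).map
      fun x => M.ρ * y.1 + √(M.ρ ^ 2 * (y.2 : ℝ) + M.γξ + M.γy) * x := by
  have h : (fun x => M.ρ * y.1 + √(M.ρ ^ 2 * (y.2 : ℝ) + M.γξ + M.γy) * x) =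
      (fun x => M.ρ * y.1 + x) ∘ fun x => √(M.ρ ^ 2 * (y.2 : ℝ) + M.γξ + M.γy) * x := rfl
  rw [h, ← Measure.map_map (by fun_prop) (by fun_prop), gaussianReal_map_const_mul,
    gaussianReal_map_const_add]
  unfold signalLaw
  congr 1
  · simp
  · ext
    simp [Real.sq_sqrt (M.signalVar_nonneg y.2), M.signalVar_nonneg y.2]

theorem continuous_postVar : Continuous fun γ : Ioi (0 : ℝ) => M.postVar γ := by
  refine Continuous.subtype_mk (f := fun γ : Ioi (0 : ℝ) =>
    (1 / (γ : ℝ) + M.ρ ^ 2 / ((M.γξ : ℝ) + M.γy))⁻¹) ?_ _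
  have h2 := M.noise_pos'
  refine Continuous.inv₀ (Continuous.add (continuous_const.div continuous_subtype_val
    fun γ => (γ.2 : (0 : ℝ) < γ).ne') continuous_const) fun γ => ?_
  have h1 : (0 : ℝ) < γ := γ.2
  positivity

theorem continuous_coe_postVar : Continuous fun γ : Ioi (0 : ℝ) => (M.postVar γ : ℝ) :=
  continuous_subtype_val.comp M.continuous_postVar

theorem continuous_loading : Continuous M.loading :=
  ((M.continuous_coe_postVar.mul continuous_const).mul
    (Continuous.sqrt (by fun_prop))).div_const _

theorem continuous_step : Continuous fun q : Y × (X × ℝ) => M.step q.1 q.2 := by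
  have := M.continuous_postVar
  have := M.continuous_loading
  unfold step
  fun_prop

theorem measurable_step (y : Y) : Measurable (M.step y) := by
  unfold step
  fun_prop

/-- This moves the dependence on the belief from the measure into the map. Integrals at different
beliefs can then be compared under one law, as continuity and monotonicity of `Q` require. -/
theorem envKernel_eq_map_step (y : Y) : M.envKernel y = M.shockLaw.map (M.step y) := by
  change (M.h.prod (M.signalLaw y)).map (M.nextState y) = _
  have h : M.h = M.h.map id := Measure.map_id.symm
  rw [signalLaw_eq_map]
  conv_lhs => rw [h]
  have hm : Measurable (M.nextState y) := M.measurable_nextState.comp measurable_prodMk_left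
  rw [Measure.map_prod_map _ _ measurable_id (by fun_prop), Measure.map_map hm (by fun_prop)]
  congr 1
  ext p : 1
  exact congrArg (fun m => ((p.1, (m, M.postVar y.2)) : Z)) (M.postMean_signal y p.2)

theorem integral_envKernel (y : Y) {F : Z → ℝ} (hF : Measurable F) :
    ∫ z, F z ∂(M.envKernel y) = ∫ p, F (M.step y p) ∂M.shockLaw := by
  rw [envKernel_eq_map_step, integral_map (M.measurable_step y).aemeasurable
    hF.aestronglyMeasurable]

theorem integrable_envKernel_iff (y : Y) {F : Z → ℝ} (hF : Measurable F) :
    Integrable F (M.envKernel y) ↔ Integrable (fun p => F (M.step y p)) M.shockLaw := by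
  rw [envKernel_eq_map_step, integrable_map_measure hF.aestronglyMeasurable
    (M.measurable_step y).aemeasurable]
  rfl

/-- The moment `exp (-a μ + a² γ / 2)` of the belief, which is a martingale. -/
def core (y : Y) : ℝ := Real.exp (-M.a * y.1 + M.a ^ 2 * (y.2 : ℝ) / 2)

theorem core_pos (y : Y) : 0 < M.core y := Real.exp_pos _

theorem continuous_core : Continuous M.core := by
  unfold core
  fun_prop

theorem measurable_core_snd : Measurable fun z : Z => M.core z.2 :=
  M.continuous_core.measurable.comp measurable_snd

theorem measurable_cost : Measurable fun z : Z => (z.1 : ℝ) :=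
  measurable_subtype_coe.comp measurable_fst

theorem core_step (y : Y) (p : X × ℝ) :
    M.core (M.step y p).2 = Real.exp (-M.a * y.1 + M.a ^ 2 * (M.postVar y.2 : ℝ) / 2) *
      Real.exp (-M.a * M.loading y.2 * p.2) := by
  rw [← Real.exp_add]
  unfold core step
  ring_nf

theorem integral_exp_mul_gaussianReal (t : ℝ) (μ : ℝ) (v : ℝ≥0) :
    ∫ x, Real.exp (t * x) ∂(gaussianReal μ v) = Real.exp (μ * t + v * t ^ 2 / 2) := by
  have h := congrFun (mgf_id_gaussianReal (μ := μ) (v := v)) t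
  exact h

theorem integrable_core (y : Y) : Integrable (fun z : Z => M.core z.2) (M.envKernel y) := by
  rw [integrable_envKernel_iff _ _ M.measurable_core_snd]
  simp_rw [core_step]
  exact ((integrable_exp_mul_gaussianReal (μ := 0) (v := 1)
    (-M.a * M.loading y.2)).comp_snd M.h).const_mul _

/-- The normal moment generating function contributes `exp (a² loading² / 2)`, which by `loading_sq`
turns `γ'` back into `γ`. -/
theorem integral_core (y : Y) : ∫ z, M.core z.2 ∂(M.envKernel y) = M.core y := by
  rw [integral_envKernel _ _ M.measurable_core_snd]
  simp_rw [core_step]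
  unfold shockLaw
  rw [integral_const_mul, integral_fun_snd (fun x => Real.exp (-M.a * M.loading y.2 * x)),
    integral_exp_mul_gaussianReal]
  simp only [probReal_univ, one_smul, NNReal.coe_one]
  rw [← Real.exp_add]
  unfold core
  rw [mul_pow, loading_sq]
  ring_nf

theorem integrable_cost (y : Y) : Integrable (fun z : Z => (z.1 : ℝ)) (M.envKernel y) := by
  rw [integrable_envKernel_iff _ _ measurable_cost]
  exact M.mean_h.comp_fst _

/-- The mean investment cost. -/
def meanCost : ℝ := ∫ f : X, (f : ℝ) ∂M.h

theorem meanCost_nonneg : 0 ≤ M.meanCost := integral_nonneg fun f => f.2.le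

theorem integral_cost (y : Y) : ∫ z : Z, (z.1 : ℝ) ∂(M.envKernel y) = M.meanCost := by
  rw [integral_envKernel _ _ measurable_cost]
  unfold shockLaw
  have h := integral_fun_fst (μ := M.h) (ν := gaussianReal 0 1) fun f : X => (f : ℝ)
  rwa [probReal_univ, one_smul] at h

theorem integrable_weight (d : ℝ) (y : Y) :
    Integrable (fun z : Z => M.weight d z.2) (M.envKernel y) :=
  (M.integrable_core y).add (integrable_const d)

theorem integral_weight (d : ℝ) (y : Y) :
    ∫ z, M.weight d z.2 ∂(M.envKernel y) = M.weight d y := by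
  have h := integral_add (M.integrable_core y) (integrable_const d)
  rw [integral_core, integral_const, probReal_univ, one_smul] at h
  exact h

theorem weight_ge {d : ℝ} (y : Y) : d ≤ M.weight d y :=
  le_add_of_nonneg_left (M.core_pos y).le

theorem weight_pos {d : ℝ} (hd : 0 < d) (y : Y) : 0 < M.weight d y := hd.trans_le (M.weight_ge y)

theorem continuous_weight (d : ℝ) : Continuous (M.weight d) :=
  M.continuous_core.add continuous_const

/-! ### Expected utility and the exit payoff. -/

/-- The factor by which the transitory variance scales `core` in the expected utility. -/
def transitoryFactor : ℝ := Real.exp (M.a ^ 2 * M.γx / 2)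

theorem transitoryFactor_pos : 0 < M.transitoryFactor := Real.exp_pos _

/-- The dividend is normal with variance `γ + γx`, so CARA utility integrates to an affine function
of `core`; hence the choice of weight. -/
theorem expUtility_eq (y : Y) :
    M.expUtility y = (1 - M.transitoryFactor * M.core y) / M.a := by
  unfold expUtility dividendLaw
  rw [gaussianReal_conv_gaussianReal]
  unfold u
  rw [integral_div, integral_sub (integrable_const _) (integrable_exp_mul_gaussianReal _),
    integral_exp_mul_gaussianReal]
  have hγ : (0 : ℝ) ≤ y.2 := (mem_Ioi.1 y.2.2).le
  unfold transitoryFactor core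
  rw [← Real.exp_add]
  simp only [integral_const, probReal_univ, one_smul, NNReal.coe_add, Real.coe_toNNReal _ hγ]
  ring_nf

theorem continuous_expUtility : Continuous M.expUtility := by
  have := M.continuous_core
  rw [funext M.expUtility_eq]
  fun_prop

theorem continuous_r : Continuous M.r := by
  have := M.continuous_expUtility
  unfold r
  fun_prop

theorem monotone_expUtility (γ : Ioi (0 : ℝ)) : Monotone fun μ : ℝ => M.expUtility (μ, γ) := by
  intro μ₁ μ₂ h
  have h1 : M.core (μ₂, γ) ≤ M.core (μ₁, γ) := by
    unfold core
    have := mul_le_mul_of_nonneg_left h M.a_pos.le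
    refine Real.exp_le_exp.2 ?_
    dsimp only
    linarith
  have := M.transitoryFactor_pos
  have := M.a_pos
  simp only [expUtility_eq]
  gcongr

theorem exists_abs_r_le {d : ℝ} (hd : 0 < d) :
    ∃ C, 0 ≤ C ∧ ∀ z : Z, |M.r z| ≤ z.1 + C * M.weight d z.2 := by
  have ha := M.a_pos
  have hT := M.transitoryFactor_pos
  -- The first summand handles the `core` term, the second the constant `1 / a`, since the weight is
  -- at least `d`.
  refine ⟨M.transitoryFactor / M.a + 1 / (M.a * d), by positivity, fun z => ?_⟩
  have hc := M.core_pos z.2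
  have hf : (0 : ℝ) < z.1 := z.1.2
  have h1 : |M.expUtility z.2| ≤ M.transitoryFactor / M.a * M.core z.2 + 1 / M.a := by
    rw [expUtility_eq, abs_div, abs_of_pos ha]
    calc |1 - M.transitoryFactor * M.core z.2| / M.a
        ≤ (|1| + |M.transitoryFactor * M.core z.2|) / M.a := by gcongr; exact abs_sub _ _
      _ = _ := by rw [abs_one, abs_of_pos (by positivity)]; ring
  have h2 : 1 / M.a ≤ 1 / (M.a * d) * M.weight d z.2 := by
    calc 1 / M.a = 1 / (M.a * d) * d := by field_simp
      _ ≤ _ := by gcongr; exact M.weight_ge z.2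
  have h3 : M.transitoryFactor / M.a * M.core z.2 ≤
      M.transitoryFactor / M.a * M.weight d z.2 := by
    gcongr
    exact le_add_of_nonneg_right hd.le
  calc |M.r z| ≤ |M.expUtility z.2| + |(z.1 : ℝ)| := abs_sub _ _
    _ = |M.expUtility z.2| + z.1 := by rw [abs_of_pos hf]
    _ ≤ _ := by linarith

end FirmEntry

/-! ### Weighted supremum norms. -/

namespace OptStop

variable {S : Type*}

theorem abs_le_weightedNorm_mul {κ f : S → ℝ} (hκ : ∀ s, 0 < κ s)
    (hf : BddAbove (range fun s => |f s| / κ s)) (s : S) : |f s| ≤ weightedNorm κ f * κ s :=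
  (div_le_iff₀ (hκ s)).1 (le_ciSup hf s)

theorem weightedNorm_le [Nonempty S] {κ f : S → ℝ} (hκ : ∀ s, 0 < κ s) {C : ℝ}
    (h : ∀ s, |f s| ≤ C * κ s) : weightedNorm κ f ≤ C :=
  ciSup_le fun s => (div_le_iff₀ (hκ s)).2 (h s)

theorem bddAbove_weighted_iff {κ f : S → ℝ} (hκ : ∀ s, 0 < κ s) :
    BddAbove (range fun s => |f s| / κ s) ↔ ∃ C, ∀ s, |f s| ≤ C * κ s := by
  simp only [bddAbove_def, forall_mem_range]
  exact exists_congr fun C => forall_congr' fun s => div_le_iff₀ (hκ s)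

theorem bddAbove_weighted_sub {κ f g : S → ℝ} (hκ : ∀ s, 0 < κ s)
    (hf : BddAbove (range fun s => |f s| / κ s)) (hg : BddAbove (range fun s => |g s| / κ s)) :
    BddAbove (range fun s => |(f - g) s| / κ s) := by
  rw [bddAbove_weighted_iff hκ] at *
  obtain ⟨A, hA⟩ := hf
  obtain ⟨B, hB⟩ := hg
  exact ⟨A + B, fun s => (abs_sub _ _).trans (by linarith [hA s, hB s])⟩

end OptStop

/-! ### The operator `Q` on the weighted spaces. -/

namespace FirmEntry

open OptStop Filter Topology

variable (M : FirmEntry)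

theorem mem_weightedSpace_iff {d : ℝ} (hd : 0 < d) {ψ : Y → ℝ} :
    ψ ∈ weightedSpace (M.weight d) ↔
      Measurable ψ ∧ ∃ C, 0 ≤ C ∧ ∀ y, |ψ y| ≤ C * M.weight d y := by
  refine and_congr_right fun _ => ?_
  rw [bddAbove_weighted_iff (M.weight_pos hd)]
  refine ⟨fun ⟨C, hC⟩ => ⟨max C 0, le_max_right _ _, fun y => (hC y).trans ?_⟩,
    fun ⟨C, _, hC⟩ => ⟨C, hC⟩⟩
  exact mul_le_mul_of_nonneg_right (le_max_left _ _) (M.weight_pos hd y).le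

/-- Weights with different positive constants are equivalent, so a fixed point built for the
constant `1` serves every `d'`. -/
theorem weightedSpace_subset {d e : ℝ} (hd : 0 < d) (he : 0 < e) :
    weightedSpace (M.weight d) ⊆ weightedSpace (M.weight e) := by
  intro ψ h
  rw [mem_weightedSpace_iff _ hd] at h
  rw [mem_weightedSpace_iff _ he]
  obtain ⟨hm, C, hC0, hC⟩ := h
  refine ⟨hm, C * (1 + d / e), by positivity, fun y => (hC y).trans ?_⟩
  have hc := M.core_pos y
  rw [mul_assoc]
  refine mul_le_mul_of_nonneg_left ?_ hC0
  change M.core y + d ≤ (1 + d / e) * (M.core y + e)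
  have h1 : (1 + d / e) * (M.core y + e) = M.core y + d + (e + d / e * M.core y) := by
    field_simp
    ring
  rw [h1]
  exact le_add_of_nonneg_right (by positivity)

/-- The payoff when the continuation value function is `ψ`. -/
def reward (ψ : Y → ℝ) (z : Z) : ℝ := max (M.r z) (ψ z.2)

theorem Q_apply (ψ : Y → ℝ) (y : Y) : M.Q ψ y = M.β * ∫ z, M.reward ψ z ∂(M.envKernel y) := rfl

variable {M} in
theorem measurable_reward {ψ : Y → ℝ} (hψ : Measurable ψ) : Measurable (M.reward ψ) :=
  M.continuous_r.measurable.max (hψ.comp measurable_snd)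

theorem exists_abs_reward_le {d : ℝ} (hd : 0 < d) {ψ : Y → ℝ}
    (hψ : ψ ∈ weightedSpace (M.weight d)) :
    ∃ C, 0 ≤ C ∧ ∀ z : Z, |M.reward ψ z| ≤ z.1 + C * M.weight d z.2 := by
  rw [mem_weightedSpace_iff _ hd] at hψ
  obtain ⟨-, A, hA0, hA⟩ := hψ
  obtain ⟨B, hB0, hB⟩ := M.exists_abs_r_le hd
  refine ⟨max A B, le_max_of_le_left hA0, fun z => abs_max_le_max_abs_abs.trans (max_le ?_ ?_)⟩
  · have := mul_le_mul_of_nonneg_right (le_max_right A B) (M.weight_pos hd z.2).le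
    linarith [hB z]
  · have := mul_le_mul_of_nonneg_right (le_max_left A B) (M.weight_pos hd z.2).le
    have hf : (0 : ℝ) < z.1 := z.1.2
    linarith [hA z.2]

theorem integrable_cost_add_weight (C d : ℝ) (y : Y) :
    Integrable (fun z : Z => (z.1 : ℝ) + C * M.weight d z.2) (M.envKernel y) :=
  (M.integrable_cost y).add ((M.integrable_weight d y).const_mul C)

theorem integral_cost_add_weight (C d : ℝ) (y : Y) :
    ∫ z : Z, ((z.1 : ℝ) + C * M.weight d z.2) ∂(M.envKernel y) =
      M.meanCost + C * M.weight d y := by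
  rw [integral_add (M.integrable_cost y) ((M.integrable_weight d y).const_mul C), integral_cost,
    integral_const_mul, integral_weight]

theorem integrable_reward {d : ℝ} (hd : 0 < d) {ψ : Y → ℝ}
    (hψ : ψ ∈ weightedSpace (M.weight d)) (y : Y) : Integrable (M.reward ψ) (M.envKernel y) := by
  obtain ⟨C, -, hC⟩ := M.exists_abs_reward_le hd hψ
  exact (M.integrable_cost_add_weight C d y).mono'
    (measurable_reward hψ.1).aestronglyMeasurable (ae_of_all _ hC)

theorem Q_mem_weightedSpace {d : ℝ} (hd : 0 < d) {ψ : Y → ℝ}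
    (hψ : ψ ∈ weightedSpace (M.weight d)) : M.Q ψ ∈ weightedSpace (M.weight d) := by
  obtain ⟨C, hC0, hC⟩ := M.exists_abs_reward_le hd hψ
  rw [mem_weightedSpace_iff _ hd]
  have hβ := M.β_pos
  have hm := M.meanCost_nonneg
  -- The mean cost is absorbed into the weight through `d ≤ weight`, which explains the summand
  -- `meanCost / d`.
  refine ⟨((measurable_reward hψ.1).stronglyMeasurable.integral_kernel
    (κ := M.envKernel)).measurable.const_mul _, M.β * (M.meanCost / d + C), by positivity,
    fun y => ?_⟩
  rw [Q_apply, abs_mul, abs_of_pos hβ, mul_assoc]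
  refine mul_le_mul_of_nonneg_left ?_ hβ.le
  calc |∫ z, M.reward ψ z ∂(M.envKernel y)| ≤ M.meanCost + C * M.weight d y := by
        rw [← integral_cost_add_weight]
        exact norm_integral_le_of_norm_le (f := M.reward ψ)
          (M.integrable_cost_add_weight C d y) (ae_of_all _ hC)
    _ = M.meanCost / d * d + C * M.weight d y := by field_simp
    _ ≤ M.meanCost / d * M.weight d y + C * M.weight d y := by gcongr; exact M.weight_ge y
    _ = _ := by ring

/-- The maximum is 1-Lipschitz in `ψ` and the weight is invariant in mean, so only the discount
factor remains. -/
theorem abs_Q_sub_le {d : ℝ} (hd : 0 < d) {ψ φ : Y → ℝ} (hψ : ψ ∈ weightedSpace (M.weight d))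
    (hφ : φ ∈ weightedSpace (M.weight d)) {C : ℝ} (hC : ∀ y, |ψ y - φ y| ≤ C * M.weight d y)
    (y : Y) : |M.Q ψ y - M.Q φ y| ≤ M.β * C * M.weight d y := by
  have hβ := M.β_pos
  rw [Q_apply, Q_apply, ← mul_sub, abs_mul, abs_of_pos hβ, mul_assoc,
    ← integral_sub (M.integrable_reward hd hψ y) (M.integrable_reward hd hφ y)]
  refine mul_le_mul_of_nonneg_left ?_ hβ.le
  rw [← integral_weight, ← integral_const_mul]
  refine norm_integral_le_of_norm_le (f := fun z => M.reward ψ z - M.reward φ z)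
    ((M.integrable_weight d y).const_mul C) (ae_of_all _ fun z => ?_)
  refine le_trans ?_ (hC z.2)
  unfold reward
  rw [max_comm (M.r z), max_comm (M.r z)]
  exact abs_max_sub_max_le_abs _ _ _

theorem weightedNorm_Q_sub_le {d : ℝ} (hd : 0 < d) {ψ φ : Y → ℝ}
    (hψ : ψ ∈ weightedSpace (M.weight d)) (hφ : φ ∈ weightedSpace (M.weight d)) :
    weightedNorm (M.weight d) (M.Q ψ - M.Q φ) ≤ M.β * weightedNorm (M.weight d) (ψ - φ) := by
  have : Nonempty Y := ⟨(0, ⟨1, mem_Ioi.2 one_pos⟩)⟩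
  exact weightedNorm_le (M.weight_pos hd) (M.abs_Q_sub_le hd hψ hφ
    (abs_le_weightedNorm_mul (M.weight_pos hd) (bddAbove_weighted_sub (M.weight_pos hd) hψ.2 hφ.2)))

theorem eq_of_Q_eq {d : ℝ} (hd : 0 < d) {ψ φ : Y → ℝ}
    (hψ : ψ ∈ weightedSpace (M.weight d)) (hφ : φ ∈ weightedSpace (M.weight d))
    (h1 : M.Q ψ = ψ) (h2 : M.Q φ = φ) : ψ = φ := by
  have h := M.weightedNorm_Q_sub_le hd hψ hφ
  rw [h1, h2] at h
  have h0 : weightedNorm (M.weight d) (ψ - φ) ≤ 0 := by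
    by_contra! h'
    have := mul_lt_of_lt_one_left h' M.β_lt_one
    linarith
  funext y
  have h3 := abs_le_weightedNorm_mul (M.weight_pos hd)
    (bddAbove_weighted_sub (M.weight_pos hd) hψ.2 hφ.2) y
  have h4 := mul_nonpos_of_nonpos_of_nonneg h0 (M.weight_pos hd y).le
  have h5 := abs_nonpos_iff.1 (h3.trans h4)
  exact sub_eq_zero.1 h5

/-- Couple two prior means by the same shock: with `γ` fixed, the posterior means keep their order,
as they differ by the same amount as the priors. -/
theorem monotone_Q {d : ℝ} (hd : 0 < d) {ψ : Y → ℝ} (hψ : ψ ∈ weightedSpace (M.weight d))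
    (hmono : ∀ γ, Monotone fun μ : ℝ => ψ (μ, γ)) (γ : Ioi (0 : ℝ)) :
    Monotone fun μ : ℝ => M.Q ψ (μ, γ) := by
  intro μ₁ μ₂ h
  have hI := fun y => (M.integrable_envKernel_iff y (measurable_reward hψ.1)).1
    (M.integrable_reward hd hψ y)
  simp only [Q_apply, integral_envKernel _ _ (measurable_reward hψ.1)]
  refine mul_le_mul_of_nonneg_left (integral_mono (hI _) (hI _) fun p => ?_) M.β_pos.le
  have h' : μ₁ + M.loading γ * p.2 ≤ μ₂ + M.loading γ * p.2 := by gcongr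
  exact max_le_max (sub_le_sub_right (M.monotone_expUtility _ h') _) (hmono _ h')

/-- Near `y₀` the coefficients in `core_step` are bounded, and `exp (c x) ≤ exp (B x) + exp (-B x)`
when `|c| ≤ B`. This is the locally uniform majorant for continuity of `Q`. -/
theorem eventually_weight_step_le (d : ℝ) (y₀ : Y) :
    ∃ A B, ∀ᶠ y in 𝓝 y₀, ∀ p : X × ℝ, M.weight d (M.step y p).2 ≤
      A * (Real.exp (B * p.2) + Real.exp (-B * p.2)) + d := by
  have hA : Continuous fun y : Y => Real.exp (-M.a * y.1 + M.a ^ 2 * (M.postVar y.2 : ℝ) / 2) :=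
    Real.continuous_exp.comp ((continuous_const.mul continuous_fst).add
      ((continuous_const.mul (M.continuous_coe_postVar.comp continuous_snd)).div_const _))
  have hB : Continuous fun y : Y => |(-M.a * M.loading y.2)| :=
    (continuous_const.mul (M.continuous_loading.comp continuous_snd)).abs
  obtain ⟨A, hA'⟩ := exists_gt (Real.exp (-M.a * y₀.1 + M.a ^ 2 * (M.postVar y₀.2 : ℝ) / 2))
  obtain ⟨B, hB'⟩ := exists_gt |(-M.a * M.loading y₀.2)|
  refine ⟨A, B, ?_⟩
  filter_upwards [(hA.tendsto y₀).eventually_lt_const hA',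
    (hB.tendsto y₀).eventually_lt_const hB'] with y hyA hyB p
  have h1 : Real.exp (-M.a * M.loading y.2 * p.2) ≤
      Real.exp (B * p.2) + Real.exp (-B * p.2) := by
    have h2 : -M.a * M.loading y.2 * p.2 ≤ |B * p.2| := by
      refine (le_abs_self _).trans ?_
      rw [abs_mul, abs_mul B]
      exact mul_le_mul_of_nonneg_right (hyB.le.trans (le_abs_self _)) (abs_nonneg _)
    refine (Real.exp_le_exp.2 h2).trans ?_
    rcases abs_cases (B * p.2) with ⟨h, -⟩ | ⟨h, -⟩ <;> rw [h]
    · exact le_add_of_nonneg_right (Real.exp_pos _).le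
    · rw [← neg_mul]
      exact le_add_of_nonneg_left (Real.exp_pos _).le
  change M.core (M.step y p).2 + d ≤ _
  rw [core_step]
  exact add_le_add (mul_le_mul hyA.le h1 (Real.exp_pos _).le ((Real.exp_pos _).le.trans hyA.le))
    le_rfl

theorem integrable_shock_bound (A B C d : ℝ) : Integrable (fun p : X × ℝ => (p.1 : ℝ) +
    C * (A * (Real.exp (B * p.2) + Real.exp (-B * p.2)) + d)) M.shockLaw := by
  have hE : ∀ t : ℝ, Integrable (fun p : X × ℝ => Real.exp (t * p.2)) M.shockLaw := fun t =>
    (integrable_exp_mul_gaussianReal (μ := 0) (v := 1) t).comp_snd M.h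
  have hf : Integrable (fun p : X × ℝ => (p.1 : ℝ)) M.shockLaw := M.mean_h.comp_fst _
  exact hf.add (((((hE B).add (hE (-B))).const_mul A).add (integrable_const d)).const_mul C)

theorem continuous_Q {d : ℝ} (hd : 0 < d) {ψ : Y → ℝ} (hψ : ψ ∈ weightedSpace (M.weight d))
    (hcont : Continuous ψ) : Continuous (M.Q ψ) := by
  obtain ⟨C, hC0, hC⟩ := M.exists_abs_reward_le hd hψ
  have hR : Continuous (M.reward ψ) := M.continuous_r.max (hcont.comp continuous_snd)
  have hQ : M.Q ψ = fun y => M.β * ∫ p, M.reward ψ (M.step y p) ∂M.shockLaw :=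
    funext fun y => by rw [Q_apply, integral_envKernel _ _ (measurable_reward hψ.1)]
  rw [hQ]
  refine continuous_const.mul (continuous_iff_continuousAt.2 fun y₀ => ?_)
  obtain ⟨A, B, hAB⟩ := M.eventually_weight_step_le d y₀
  refine continuousAt_of_dominated ?_ ?_ (M.integrable_shock_bound A B C d) ?_
  · exact Eventually.of_forall fun y =>
      ((measurable_reward hψ.1).comp (M.measurable_step y)).aestronglyMeasurable
  · filter_upwards [hAB] with y hy
    exact ae_of_all _ fun p => (hC _).trans
      (add_le_add le_rfl (mul_le_mul_of_nonneg_left (hy p) hC0))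
  · have h : ∀ p, Continuous fun y : Y => M.reward ψ (M.step y p) := fun p =>
      hR.comp (M.continuous_step.comp (continuous_id.prodMk continuous_const))
    exact ae_of_all _ fun p => (h p).continuousAt

/-! ### The fixed point of `Q` as a limit of iterates. -/

/-- The approximations of the continuation value obtained by iterating `Q`. -/
def iter (n : ℕ) : Y → ℝ := M.Q^[n] 0

theorem iter_succ (n : ℕ) : M.iter (n + 1) = M.Q (M.iter n) :=
  Function.iterate_succ_apply' _ _ _

theorem zero_mem_weightedSpace : (0 : Y → ℝ) ∈ weightedSpace (M.weight 1) :=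
  (M.mem_weightedSpace_iff one_pos).2 ⟨measurable_const, 0, le_rfl, fun y => by simp⟩

theorem iter_mem (n : ℕ) : M.iter n ∈ weightedSpace (M.weight 1) := by
  induction n with
  | zero => exact M.zero_mem_weightedSpace
  | succ n ih => exact M.iter_succ n ▸ M.Q_mem_weightedSpace one_pos ih

theorem continuous_iter (n : ℕ) : Continuous (M.iter n) := by
  induction n with
  | zero => exact continuous_const
  | succ n ih => exact M.iter_succ n ▸ M.continuous_Q one_pos (M.iter_mem n) ih

theorem monotone_iter (n : ℕ) (γ : Ioi (0 : ℝ)) : Monotone fun μ : ℝ => M.iter n (μ, γ) := by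
  induction n generalizing γ with
  | zero => exact monotone_const
  | succ n ih => exact M.iter_succ n ▸ M.monotone_Q one_pos (M.iter_mem n) ih γ

theorem exists_abs_iter_sub_le : ∃ C, ∀ n y,
    |M.iter n y - M.iter (n + 1) y| ≤ C * M.weight 1 y * M.β ^ n := by
  obtain ⟨-, C, -, hC⟩ := (M.mem_weightedSpace_iff one_pos).1 (M.iter_mem 1)
  refine ⟨C, fun n => ?_⟩
  induction n with
  | zero =>
    intro y
    have h : M.iter 0 y = 0 := rfl
    rw [h, zero_sub, abs_neg, pow_zero, mul_one]
    exact hC y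
  | succ n ih =>
    intro y
    have h := M.abs_Q_sub_le one_pos (M.iter_mem n) (M.iter_mem (n + 1))
      (C := C * M.β ^ n) (fun y => (ih y).trans_eq (by ring)) y
    rw [← iter_succ, ← iter_succ] at h
    exact h.trans_eq (by ring)

theorem exists_fixedPoint : ∃ ψ : Y → ℝ, ψ ∈ weightedSpace (M.weight 1) ∧ M.Q ψ = ψ ∧
    Continuous ψ ∧ ∀ γ, Monotone fun μ : ℝ => ψ (μ, γ) := by
  obtain ⟨C, hC⟩ := M.exists_abs_iter_sub_le
  have hβ := M.β_lt_one
  have hw := M.weight_pos one_pos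
  have hlim : ∀ y, ∃ l, Tendsto (fun n => M.iter n y) atTop (𝓝 l) := fun y =>
    cauchySeq_tendsto_of_complete (cauchySeq_of_le_geometric M.β _ hβ fun n => hC n y)
  choose ψ hψ using hlim
  have hdist : ∀ n y, |M.iter n y - ψ y| ≤ C / (1 - M.β) * M.β ^ n * M.weight 1 y := fun n y =>
    (dist_le_of_le_geometric_of_tendsto M.β _ hβ (fun n => hC n y) (hψ y) n).trans_eq (by ring)
  have hrate : Tendsto (fun n => C / (1 - M.β) * M.β ^ n) atTop (𝓝 0) := by
    simpa using (tendsto_pow_atTop_nhds_zero_of_lt_one M.β_pos.le hβ).const_mul (C / (1 - M.β))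
  have hcont : Continuous ψ := by
    -- The error bound is proportional to the unbounded weight, so uniform convergence is obtained
    -- after dividing by it.
    have h1 : TendstoUniformly (fun n y => M.iter n y / M.weight 1 y)
        (fun y => ψ y / M.weight 1 y) atTop := by
      refine Metric.tendstoUniformly_iff.2 fun ε hε => ?_
      filter_upwards [hrate.eventually_lt_const hε] with n hn y
      rw [dist_comm, Real.dist_eq, ← sub_div, abs_div, abs_of_pos (hw y), div_lt_iff₀ (hw y)]
      exact (hdist n y).trans_lt (mul_lt_mul_of_pos_right hn (hw y))
    have h2 := h1.continuous (Frequently.of_forall fun n =>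
      (M.continuous_iter n).div (M.continuous_weight 1) fun y => (hw y).ne')
    have h3 : ψ = fun y => ψ y / M.weight 1 y * M.weight 1 y :=
      funext fun y => (div_mul_cancel₀ _ (hw y).ne').symm
    rw [h3]
    exact h2.mul (M.continuous_weight 1)
  have hmem : ψ ∈ weightedSpace (M.weight 1) := by
    refine ⟨hcont.measurable, (bddAbove_weighted_iff hw).2 ⟨C / (1 - M.β), fun y => ?_⟩⟩
    have h : M.iter 0 y = 0 := rfl
    have h' := hdist 0 y
    rwa [h, zero_sub, abs_neg, pow_zero, mul_one] at h'
  refine ⟨ψ, hmem, funext fun y => ?_, hcont, fun γ μ₁ μ₂ h =>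
    le_of_tendsto_of_tendsto' (hψ _) (hψ _) fun n => M.monotone_iter n γ h⟩
  -- The shifted iterates tend to `ψ`, and also to `Q ψ` because `Q` is Lipschitz in the weighted
  -- sense.
  refine tendsto_nhds_unique ?_ ((hψ y).comp (tendsto_add_atTop_nat 1))
  rw [tendsto_iff_dist_tendsto_zero]
  have h0 : Tendsto (fun n => M.β * (C / (1 - M.β) * M.β ^ n) * M.weight 1 y) atTop (𝓝 0) := by
    simpa using (hrate.const_mul M.β).mul_const (M.weight 1 y)
  refine squeeze_zero (fun _ => dist_nonneg) (fun n => ?_) h0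
  rw [Function.comp_apply, iter_succ]
  exact M.abs_Q_sub_le one_pos (M.iter_mem n) hmem (hdist n) y

/-- Payoffs also involve the unbounded cost, so `W` is the cost plus a multiple of the belief
weight. It is no longer invariant, but the discount leaves room for a drift factor `K` in `(1, 1 /
β)`. -/
theorem isBellmanSolution {ψ : Y → ℝ} (hψ : ψ ∈ weightedSpace (M.weight 1)) (hQ : M.Q ψ = ψ) :
    ∃ W K, IsBellmanSolution M.P M.β M.r W (M.reward ψ) K := by
  obtain ⟨A, hA0, hA⟩ := M.exists_abs_reward_le one_pos hψ
  obtain ⟨B, hB0, hB⟩ := M.exists_abs_r_le one_pos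
  have hβ0 := M.β_pos
  have hβ1 := M.β_lt_one
  obtain ⟨K, hK1, hK2⟩ : ∃ K, 1 < K ∧ K < 1 / M.β :=
    exists_between ((one_lt_div hβ0).2 hβ1)
  have hm := M.meanCost_nonneg
  -- `A + B` dominates both payoff bounds; the last summand gives `meanCost ≤ (K - 1) * D`, so, as
  -- the weight is at least `1`, the expected new cost fits into the slack of the drift condition.
  obtain ⟨D, hD⟩ : ∃ D, D = A + B + M.meanCost / (K - 1) := ⟨_, rfl⟩
  have hmK : 0 ≤ M.meanCost / (K - 1) := div_nonneg hm (by linarith)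
  have hle : ∀ C ≤ D, ∀ z : Z, (z.1 : ℝ) + C * M.weight 1 z.2 ≤ z.1 + D * M.weight 1 z.2 :=
    fun C hC z => add_le_add le_rfl (mul_le_mul_of_nonneg_right hC (M.weight_pos one_pos _).le)
  have hD0 : 0 ≤ D := by linarith
  have hW0 : ∀ z : Z, 0 ≤ (z.1 : ℝ) + D * M.weight 1 z.2 := fun z =>
    add_nonneg (mem_Ioi.1 z.1.2).le (mul_nonneg hD0 (M.weight_pos one_pos _).le)
  refine ⟨fun z => (z.1 : ℝ) + D * M.weight 1 z.2, K, hβ0.le, by linarith, ?_,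
    M.continuous_r.measurable, ?_, measurable_reward hψ.1,
    fun z => (hB z).trans (hle B (by linarith) z), fun z => (hA z).trans (hle A (by linarith) z),
    fun z => ?_, fun z => ?_⟩
  · rw [mul_comm]
    exact (lt_div_iff₀ hβ0).1 hK2
  · exact measurable_cost.add
      (((M.continuous_weight 1).measurable.comp measurable_snd).const_mul D)
  · change ∫⁻ z' : Z, ENNReal.ofReal ((z'.1 : ℝ) + D * M.weight 1 z'.2) ∂(M.envKernel z.2) ≤ _
    rw [← ofReal_integral_eq_lintegral_ofReal (M.integrable_cost_add_weight D 1 z.2)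
      (ae_of_all _ hW0), integral_cost_add_weight]
    refine ENNReal.ofReal_le_ofReal ?_
    have h1 : M.meanCost ≤ (K - 1) * D := by
      calc M.meanCost = (K - 1) * (M.meanCost / (K - 1)) :=
            (mul_div_cancel₀ _ (by linarith)).symm
        _ ≤ _ := mul_le_mul_of_nonneg_left (by linarith) (by linarith)
    have h2 : (K - 1) * D * 1 ≤ (K - 1) * D * M.weight 1 z.2 :=
      mul_le_mul_of_nonneg_left (M.weight_ge _) (mul_nonneg (by linarith) hD0)
    have h3 : 0 ≤ K * (z.1 : ℝ) := mul_nonneg (by linarith) (mem_Ioi.1 z.1.2).le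
    linarith
  · exact congrArg (max (M.r z)) (congrFun hQ z.2).symm

theorem reservationPolicy_eq_one_iff (fbar : Y → ℝ) (z : Z) :
    reservationPolicy fbar z = 1 ↔ (z.1 : ℝ) ≤ fbar z.2 := by
  unfold reservationPolicy
  split_ifs with h <;> simp [h]

theorem measurable_reservationPolicy {fbar : Y → ℝ} (hf : Measurable fbar) :
    Measurable (reservationPolicy fbar) := by
  unfold reservationPolicy
  exact Measurable.ite (measurableSet_le measurable_cost
    (hf.comp measurable_snd)) measurable_const measurable_const

end FirmEntry

end

/-! ### Assembly: identification of the value and continuation value functions. -/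

theorem mainTheorem11 (M : FirmEntry) :
    -- the expected payoffs, the value function and the continuation value are well defined
    ((∀ (z : FirmEntry.Z) (τ : (ℕ → FirmEntry.Z) → WithTop ℕ), OptStop.IsStopping τ →
        Integrable (OptStop.payoff M.β M.r FirmEntry.c τ) (OptStop.pathLaw M.P z)) ∧
      (∀ z, IsLUB (OptStop.finitePayoffs M.P M.β M.r FirmEntry.c z) (M.vStar z)) ∧
      (∀ y, Integrable M.vStar (M.envKernel y))) ∧
    -- 1. contraction property of `Q` and its fixed point
    (∀ d' : ℝ, 0 < d' →
      (∀ ψ ∈ OptStop.weightedSpace (M.weight d'),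
        (∀ y, Integrable (fun z' : FirmEntry.Z => max (M.r z') (ψ z'.2)) (M.envKernel y)) ∧
        M.Q ψ ∈ OptStop.weightedSpace (M.weight d')) ∧
      (∀ ψ ∈ OptStop.weightedSpace (M.weight d'), ∀ φ ∈ OptStop.weightedSpace (M.weight d'),
        OptStop.weightedNorm (M.weight d') (M.Q ψ - M.Q φ) ≤
          M.β * OptStop.weightedNorm (M.weight d') (ψ - φ)) ∧
      M.ψStar ∈ OptStop.weightedSpace (M.weight d') ∧
      (∀ ψ ∈ OptStop.weightedSpace (M.weight d'), M.Q ψ = ψ ↔ ψ = M.ψStar)) ∧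
    -- 2. value function
    (∀ z : FirmEntry.Z, M.vStar z = max (M.r z) (M.ψStar z.2)) ∧
    -- 2. and 3. reservation cost, optimal policy, continuity of the reservation cost
    (∃ fbar : FirmEntry.Y → ℝ,
      (∀ g : FirmEntry.Y → ℝ, M.IsReservationCost g ↔ g = fbar) ∧
      (∀ y, fbar y = M.expUtility y - M.ψStar y) ∧
      OptStop.IsOptimalPolicy M.P M.β M.r FirmEntry.c (FirmEntry.reservationPolicy fbar) ∧
      Continuous fbar) ∧
    -- 3. continuity of the continuation value and of the value function
    Continuous M.ψStar ∧ Continuous M.vStar ∧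
    -- 4. monotonicity
    (∀ y : FirmEntry.Y, Antitone fun f : FirmEntry.X => M.vStar (f, y)) ∧
    (0 ≤ M.ρ →
      (∀ γ : Ioi (0 : ℝ), Monotone fun μ : ℝ => M.ψStar (μ, γ)) ∧
      (∀ (f : FirmEntry.X) (γ : Ioi (0 : ℝ)), Monotone fun μ : ℝ => M.vStar (f, (μ, γ)))) := by
  obtain ⟨ψ, hmem, hQ, hcont, hmono⟩ := M.exists_fixedPoint
  obtain ⟨W, K, H⟩ := M.isBellmanSolution hmem hQ
  -- The kernel ignores the current cost, so the fixed-point equation on beliefs is the continuation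
  -- value at every state.
  have hβ : ∀ z : FirmEntry.Z, M.β * ∫ z', M.reward ψ z' ∂(M.P z) = ψ z.2 := fun z =>
    congrFun hQ z.2
  have hfm : Continuous fun y => M.expUtility y - ψ y := M.continuous_expUtility.sub hcont
  have hσm := FirmEntry.measurable_reservationPolicy hfm.measurable
  have hσ : ∀ z, FirmEntry.reservationPolicy (fun y => M.expUtility y - ψ y) z = 1 ↔
      M.β * ∫ z', M.reward ψ z' ∂(M.P z) ≤ M.r z := fun z => by
    rw [FirmEntry.reservationPolicy_eq_one_iff, hβ, FirmEntry.r]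
    exact le_sub_comm
  have hv : M.vStar = M.reward ψ := funext fun z => H.value_eq hσm hσ z
  have hψ : M.ψStar = ψ := by
    refine Eq.trans ?_ hQ
    unfold FirmEntry.ψStar
    rw [hv]
    rfl
  have hvc : Continuous M.vStar := hv ▸ M.continuous_r.max (hcont.comp continuous_snd)
  have hopt := H.isOptimalPolicy hσm hσ
  refine ⟨⟨fun z τ hτ => H.integrable_payoff z hτ, fun z => ?_, fun y => ?_⟩,
    fun d hd => ⟨fun φ hφ => ⟨M.integrable_reward hd hφ, M.Q_mem_weightedSpace hd hφ⟩,
      fun φ hφ χ hχ => M.weightedNorm_Q_sub_le hd hφ hχ, ?_, fun φ hφ => ?_⟩, fun z => ?_,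
    ⟨fun y => M.expUtility y - ψ y, fun g => ?_, fun y => by rw [hψ], hopt, hfm⟩,
    hψ ▸ hcont, hvc, fun y f₁ f₂ h => ?_, fun _ => ⟨fun γ => hψ ▸ hmono γ, fun f γ μ₁ μ₂ h => ?_⟩⟩
  · rw [hv]
    exact H.isLUB_finitePayoffs z hopt.1 (H.expPayoff_policyTime hσm hσ z)
  · rw [hv]
    exact M.integrable_reward one_pos hmem y
  · rw [hψ]
    exact M.weightedSpace_subset one_pos hd hmem
  · rw [hψ]
    exact ⟨fun h => M.eq_of_Q_eq hd hφ (M.weightedSpace_subset one_pos hd hmem) h hQ,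
      fun h => h ▸ hQ⟩
  · rw [hv, hψ]
    rfl
  · rw [FirmEntry.IsReservationCost, hψ, funext_iff]
    exact forall_congr' fun y => by rw [sub_eq_iff_eq_add, eq_sub_iff_add_eq, eq_comm, add_comm]
  · simp only [hv]
    exact max_le_max (sub_le_sub_left (Subtype.coe_le_coe.2 h) _) le_rfl
  · simp only [hv]
    exact max_le_max (sub_le_sub_right (M.monotone_expUtility γ h) _) (hmono γ h)
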